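/- **Setting.** Let $d\ge 0$, let $\mathcal W$ be a measurable space, and let $Z=(X,W,Y)\sim\mathbb P$ take values in $\mathbb R^d\times\mathcal W\times\mathbb R$ and follow the partially linear model $$Y=\langle\theta_0,X\rangle+g_0(W)+\epsilon,\qquad \mathbb E_{\mathbb P}[\epsilon\mid X,W]=0,$$ with $\theta_0\in\mathbb R^d$ and $g_0:\mathcal W\to\mathbb R$ measurable. Assume that there are constants $\lambda_0,C_X,\sigma>0$ with (a) $\lambda_{\min}(\mathbb E_{\mathbb P}[XX^\top])\ge\lambda_0$; (b) $\|X\|_\infty\le C_X$ almost surely and $\mathbb E_{\mathbb P}[\epsilon^2]\le\sigma^2$. Consider the loss $\ell(\theta,g;(x,w,y))=\frac12\,(y-g(w)-\langle\theta,x\rangle)^2$, its score $S_\theta(\theta,g;z)=\nabla_\theta\ell(\theta,g;z)=-(y-g(w)-\langle\theta,x\rangle)\,x$, a target $\theta_\star\in\operatorname{argmin}_{\theta\in\mathbb R^d}\mathbb E_{\mathbb P}[\ell(\theta,g_0;Z)]$, and the norm $\|h\|_{\mathcal G}=\mathbb E_{\mathbb P}[h(W)^2]^{1/2}\in[0,\infty]$.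 Let $$\eta_{\max}=\sup\Big\{\eta>0:\ \operatorname{tr}\big(A^\top\mathbb E_{\mathbb P}[XX^\top]A\big)-\eta\,\mathbb E_{\mathbb P}\big[(X^\top AX)^2\big]>0\ \text{ for all symmetric } A\in\mathbb R^{d\times d},\ A\ne0\Big\},$$ and fix a step size $\eta$ and an initial point $\theta^{(0)}\in\mathbb R^d$. **Proposition.** If $0<\eta<\eta_{\max}$, then there is a constant $C<\infty$, depending only on the data above (namely $\mathbb P,\theta_0,g_0,\lambda_0,C_X,\sigma,\theta_\star,\eta,\theta^{(0)}$), such that the following holds for every $n\ge1$. Let $Z_1,\dots,Z_n$ be i.i.d. with law $\mathbb P$, defined on some probability space, let $\mathcal A$ be a $\sigma$-algebra independent of $(Z_1,\dots,Z_n)$ (the information in the auxiliary data), and let $\hat g=\hat g(\omega,w)$ be any $\mathcal A\otimes\mathcal W$-measurable random function $\mathcal W\to\mathbb R$ (for instance, a fixed measurable function). Put $$\theta^{(t)}=\theta^{(t-1)}-\eta\,S_\theta(\theta^{(t-1)},\hat g;Z_t)\quad(t\ge1),\qquad \bar\theta^{(n)}=\frac1n\sum_{t=0}^{n-1}\theta^{(t)}.$$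 Then, almost surely, $$\mathbb E\big[\|\bar\theta^{(n)}-\theta_\star\|_2^2\,\big|\,\mathcal A\big]\le C\Big(\frac1n+\|\hat g-g_0\|_{\mathcal G}^2\Big),$$ and consequently $\mathbb E\|\bar\theta^{(n)}-\theta_\star\|_2^2\le C\big(\frac1n+\mathbb E\|\hat g-g_0\|_{\mathcal G}^2\big)$. -/

import Mathlib

open MeasureTheory ProbabilityTheory
open scoped ENNReal NNReal RealInnerProductSpace

namespace PLM

/-- An observation `z = (x, w, y)`: input `x ∈ ℝ^d`, control `w ∈ 𝒲`, real outcome `y`. -/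
abbrev Obs (d : ℕ) (𝒲 : Type*) : Type _ := EuclideanSpace ℝ (Fin d) × 𝒲 × ℝ

/-- The non-orthogonal squared loss `ℓ(θ, g; (x, w, y)) = ½ (y - g(w) - ⟨θ, x⟩)²`. -/
noncomputable def loss {d : ℕ} {𝒲 : Type*} (θ : EuclideanSpace ℝ (Fin d)) (g : 𝒲 → ℝ)
    (z : Obs d 𝒲) : ℝ :=
  (1 / 2) * (z.2.2 - g z.2.1 - ⟪θ, z.1⟫) ^ 2

/-- The population risk `L(θ, g) = E_P[ℓ(θ, g; Z)]`. -/
noncomputable def risk {d : ℕ} {𝒲 : Type*} [MeasurableSpace 𝒲] (P : Measure (Obs d 𝒲))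
    (θ : EuclideanSpace ℝ (Fin d)) (g : 𝒲 → ℝ) : ℝ :=
  ∫ z, loss θ g z ∂P

/-- The score `S_θ(θ, g; z) = ∇_θ ℓ(θ, g; z)`. -/
noncomputable def score {d : ℕ} {𝒲 : Type*} (θ : EuclideanSpace ℝ (Fin d)) (g : 𝒲 → ℝ)
    (z : Obs d 𝒲) : EuclideanSpace ℝ (Fin d) :=
  gradient (fun θ' => loss θ' g z) θ

/-- The explicit form of the score: `S_θ(θ, g; z) = -(y - g(w) - ⟨θ, x⟩) x`. -/
theorem score_eq {d : ℕ} {𝒲 : Type*} (θ : EuclideanSpace ℝ (Fin d)) (g : 𝒲 → ℝ)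
    (z : Obs d 𝒲) : score θ g z = -((z.2.2 - g z.2.1 - ⟪θ, z.1⟫) • z.1) := by
  apply HasGradientAt.gradient
  rw [hasGradientAt_iff_hasFDerivAt]
  have h0 : HasFDerivAt (fun θ' : EuclideanSpace ℝ (Fin d) => ⟪θ', z.1⟫)
      (innerSL ℝ z.1) θ := by
    have h := (innerSL ℝ z.1).hasFDerivAt (x := θ)
    refine h.congr_of_eventuallyEq (Filter.Eventually.of_forall fun θ' => ?_)
    simp [real_inner_comm]
  have h1 := ((h0.const_sub (z.2.2 - g z.2.1)).pow 2).const_mul (1 / 2 : ℝ)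
  refine h1.congr_fderiv ?_
  ext v
  simp
  ring

/-- The SGD iterates with constant step size `η` started at `θinit`:
`θ⁽⁰⁾ = θinit` and `θ⁽ᵗ⁺¹⁾ = θ⁽ᵗ⁾ - η S_θ(θ⁽ᵗ⁾, g; z_{t+1})`. -/
noncomputable def sgd {d : ℕ} {𝒲 : Type*} (η : ℝ) (θinit : EuclideanSpace ℝ (Fin d))
    (g : 𝒲 → ℝ) (z : ℕ → Obs d 𝒲) : ℕ → EuclideanSpace ℝ (Fin d)
  | 0 => θinit
  | t + 1 => sgd η θinit g z t - η • score (sgd η θinit g z t) g (z (t + 1))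

/-- Averaged SGD: `θ̄⁽ⁿ⁾ = (1/n) ∑_{t=0}^{n-1} θ⁽ᵗ⁾`, for `n ≥ 1`. -/
noncomputable def avgSGD {d : ℕ} {𝒲 : Type*} (η : ℝ) (θinit : EuclideanSpace ℝ (Fin d))
    (g : 𝒲 → ℝ) (z : ℕ → Obs d 𝒲) (n : ℕ) : EuclideanSpace ℝ (Fin d) :=
  (1 / (n : ℝ)) • ∑ t ∈ Finset.range n, sgd η θinit g z t

/-- The second moment matrix `E_P[X Xᵀ]`. -/
noncomputable def secondMoment {d : ℕ} {𝒲 : Type*} [MeasurableSpace 𝒲]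
    (P : Measure (Obs d 𝒲)) : Matrix (Fin d) (Fin d) ℝ :=
  Matrix.of fun i j => ∫ z, z.1 i * z.1 j ∂P

/-- The quadratic form `xᵀ A x`. -/
def quadForm {d : ℕ} (A : Matrix (Fin d) (Fin d) ℝ) (x : EuclideanSpace ℝ (Fin d)) : ℝ :=
  x.ofLp ⬝ᵥ A.mulVec x.ofLp

/-- `η_max`, the supremum of the `η > 0` such that `tr(Aᵀ E[X Xᵀ] A) - η E[(Xᵀ A X)²] > 0` for
all symmetric `A ≠ 0`; taken in the extended reals, so that it is a genuine supremum. -/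
noncomputable def etaMax {d : ℕ} {𝒲 : Type*} [MeasurableSpace 𝒲] (P : Measure (Obs d 𝒲)) :
    EReal :=
  sSup ((fun η : ℝ => (η : EReal)) '' {η : ℝ | 0 < η ∧
    ∀ A : Matrix (Fin d) (Fin d) ℝ, A.IsSymm → A ≠ 0 →
      0 < (A.transpose * secondMoment P * A).trace - η * ∫ z, quadForm A z.1 ^ 2 ∂P})

/-- The residual `ε = y - g(w) - ⟨θ, x⟩` at `(θ, g)`. -/
noncomputable def residual {d : ℕ} {𝒲 : Type*} (θ : EuclideanSpace ℝ (Fin d)) (g : 𝒲 → ℝ)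
    (z : Obs d 𝒲) : ℝ :=
  z.2.2 - g z.2.1 - ⟪θ, z.1⟫

/-- The nuisance norm `‖h‖_𝒢 = E_P[h(W)²]^{1/2}`, as an extended non-negative real. -/
noncomputable def nuisanceNorm {d : ℕ} {𝒲 : Type*} [MeasurableSpace 𝒲] (P : Measure (Obs d 𝒲))
    (h : 𝒲 → ℝ) : ℝ≥0∞ :=
  eLpNorm (fun z : Obs d 𝒲 => h z.2.1) 2 P

/-- `Z₁, …, Z_n` are independent observations with law `P`. -/
structure IsSample {d : ℕ} {𝒲 Ω : Type*} [MeasurableSpace 𝒲] [MeasurableSpace Ω]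
    (μ : Measure Ω) (P : Measure (Obs d 𝒲)) (Z : ℕ → Ω → Obs d 𝒲) (n : ℕ) : Prop where
  measurable : ∀ i ∈ Finset.Icc 1 n, Measurable (Z i)
  law : ∀ i ∈ Finset.Icc 1 n, μ.map (Z i) = P
  indep : iIndepFun (fun i : Finset.Icc 1 n => Z i) μ

/-- `ĝ` is a random nuisance function computed from auxiliary data, with information
σ-algebra `m`, that is independent of `σ(Z₁, …, Z_n)`. -/
structure IsIndepEstimator {d : ℕ} {𝒲 Ω : Type*} [MeasurableSpace 𝒲]
    (m : MeasurableSpace Ω) [mΩ : MeasurableSpace Ω] (μ : Measure Ω)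
    (Z : ℕ → Ω → Obs d 𝒲) (n : ℕ) (ghat : Ω → 𝒲 → ℝ) : Prop where
  le : m ≤ mΩ
  measurable : Measurable[m.prod inferInstance] (Function.uncurry ghat)
  indep : Indep m (⨆ i ∈ Finset.Icc 1 n, MeasurableSpace.comap (Z i) inferInstance) μ

end PLM

/-! Freeze a measurable `g`. Put δ_t = θ⁽ᵗ⁾ - θ₀, H = E[X Xᵀ], and let e = ε - (g - g₀)(W) be the
residual at (θ₀, g). The error obeys δ_{t+1} = (1 - ηXXᵀ)δ_t + ηeX. The noise eX need not be
centred: as ε is orthogonal to X, its mean is γ = -E[(g - g₀)(W)X], and |γ| ≤ R‖g - g₀‖ when |X| ≤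
R.

Stability. Let T(A) = E[(1 - ηXXᵀ)A(1 - ηXXᵀ)]. For symmetric A, tr(A T(A)) = tr A² - 2η tr(AHA) +
η²E[(XᵀAX)²], and the step-size condition makes this at most tr A² - η tr(AHA). Tested on the
partial sums of ∑ Tᵏ(1), this bounds their traces uniformly, and a multiple of such a sum is a
Lyapunov form (`exists_lyapunov`). With noise it still contracts geometrically up to a multiple of
E[e²] (`exists_drift`), so E|δ_t|² is at most a constant times 1 + ‖g - g₀‖², uniformly in t.

Averaging. Summing the recursion gives ηH ∑_{t<n} δ_t = U_n - δ_n + nηγ, where U is a martingale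
(`fluctuation`) with E|U_n|² = O(n(1 + ‖g - g₀‖²)). Since H ≥ λ₀, dividing by n yields the rate 1/n
+ ‖g - g₀‖², the last term being the bias γ (`norm_avgSGD_sub_le`, `exists_mse_bound`).

Independence then allows ĝ to be frozen under the conditional expectation (`condLExp_mse_le`), and
θ⋆ = θ₀ because the risk at g₀ is strictly convex (`eq_of_isMinOn_risk`). -/

namespace PLM

/-- A continuous function of an almost surely bounded random vector is integrable. -/
theorem integrable_continuous_comp_of_bounded {Ω E : Type*} [MeasurableSpace Ω]
    [NormedAddCommGroup E] [ProperSpace E] [MeasurableSpace E] [BorelSpace E]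
    {F : Type*} [NormedAddCommGroup F] [SecondCountableTopologyEither E F]
    {P : Measure Ω} [IsFiniteMeasure P] {X : Ω → E} (hX : Measurable X) {R : ℝ}
    (hR : ∀ᵐ ω ∂P, ‖X ω‖ ≤ R) {f : E → F} (hf : Continuous f) :
    Integrable (fun ω => f (X ω)) P := by
  obtain ⟨C, hC⟩ := (isCompact_closedBall (0 : E) R).exists_bound_of_continuousOn hf.continuousOn
  refine Integrable.of_bound (hf.stronglyMeasurable.comp_measurable hX).aestronglyMeasurable C ?_
  filter_upwards [hR] with ω hω
  exact hC _ (by simpa using hω)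

/-! ### Quadratic forms, the transfer operator and the Lyapunov form -/

section Matrix

open Matrix

variable {d : ℕ}

/-- Factor A = C*C; by cyclicity the trace is that of the positive semidefinite matrix CBC*. -/
theorem PosSemidef.trace_mul_nonneg {A B : Matrix (Fin d) (Fin d) ℝ} (hA : A.PosSemidef)
    (hB : B.PosSemidef) : 0 ≤ (A * B).trace := by
  open scoped MatrixOrder in
  obtain ⟨C, rfl⟩ := CStarAlgebra.nonneg_iff_eq_star_mul_self.mp hA.nonneg
  rw [Matrix.mul_assoc, Matrix.trace_mul_comm, star_eq_conjTranspose]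
  exact (hB.mul_mul_conjTranspose_same C).trace_nonneg

theorem quadForm_eq_trace (A : Matrix (Fin d) (Fin d) ℝ) (x : EuclideanSpace ℝ (Fin d)) :
    quadForm A x = (vecMulVec x.ofLp x.ofLp * A).trace := by
  rw [Matrix.trace_mul_comm, mul_vecMulVec, trace_vecMulVec, quadForm, dotProduct_comm]

theorem quadForm_nonneg {A : Matrix (Fin d) (Fin d) ℝ} (hA : A.PosSemidef)
    (x : EuclideanSpace ℝ (Fin d)) : 0 ≤ quadForm A x := by
  simpa [quadForm] using hA.dotProduct_mulVec_nonneg x.ofLp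

theorem quadForm_one (x : EuclideanSpace ℝ (Fin d)) : quadForm 1 x = ‖x‖ ^ 2 := by
  rw [EuclideanSpace.real_norm_sq_eq]; simp [quadForm, dotProduct, pow_two]

theorem quadForm_sub (A B : Matrix (Fin d) (Fin d) ℝ) (x : EuclideanSpace ℝ (Fin d)) :
    quadForm (A - B) x = quadForm A x - quadForm B x := by
  simp [quadForm, sub_mulVec, dotProduct_sub]

theorem quadForm_add (A B : Matrix (Fin d) (Fin d) ℝ) (x : EuclideanSpace ℝ (Fin d)) :
    quadForm (A + B) x = quadForm A x + quadForm B x := by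
  simp [quadForm, add_mulVec, dotProduct_add]

theorem quadForm_smul (c : ℝ) (A : Matrix (Fin d) (Fin d) ℝ) (x : EuclideanSpace ℝ (Fin d)) :
    quadForm (c • A) x = c * quadForm A x := by
  simp [quadForm, smul_mulVec]

theorem quadForm_smul_vec (A : Matrix (Fin d) (Fin d) ℝ) (c : ℝ) (x : EuclideanSpace ℝ (Fin d)) :
    quadForm A (c • x) = c ^ 2 * quadForm A x := by
  simp [quadForm, mulVec_smul]; ring

theorem continuous_quadForm (A : Matrix (Fin d) (Fin d) ℝ) : Continuous (quadForm A) := by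
  unfold quadForm
  fun_prop

/-- By Cauchy–Schwarz, xxᵀ ≤ |x|²·1; pair this with A under the trace. -/
theorem quadForm_le_trace_mul {A : Matrix (Fin d) (Fin d) ℝ} (hA : A.PosSemidef)
    (x : EuclideanSpace ℝ (Fin d)) : quadForm A x ≤ A.trace * ‖x‖ ^ 2 := by
  have hB : ((‖x‖ ^ 2) • (1 : Matrix (Fin d) (Fin d) ℝ) - vecMulVec x.ofLp x.ofLp).PosSemidef := by
    refine PosSemidef.of_dotProduct_mulVec_nonneg ?_ fun v => ?_
    · ext i j
      simp [vecMulVec_apply, mul_comm, Matrix.one_apply, eq_comm]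
    · have h := real_inner_mul_inner_self_le (WithLp.toLp 2 v) x
      have h1 : (⟪WithLp.toLp 2 v, x⟫ : ℝ) = v ⬝ᵥ x.ofLp := by
        simp [PiLp.inner_apply, dotProduct, mul_comm]
      have h2 : (⟪WithLp.toLp 2 v, WithLp.toLp 2 v⟫ : ℝ) = v ⬝ᵥ v := by
        rw [real_inner_self_eq_norm_sq, EuclideanSpace.real_norm_sq_eq]; simp [dotProduct, pow_two]
      rw [h1, h2, real_inner_self_eq_norm_sq] at h
      simp only [star_trivial, sub_mulVec, smul_mulVec, one_mulVec, vecMulVec_mulVec,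
        dotProduct_sub, dotProduct_smul, smul_eq_mul, op_smul_eq_smul]
      rw [dotProduct_comm x.ofLp v]
      linarith
  have h := PosSemidef.trace_mul_nonneg hA hB
  rw [quadForm_eq_trace, Matrix.trace_mul_comm]
  simp only [Matrix.mul_sub, trace_sub, Matrix.mul_smul, mul_one, trace_smul, smul_eq_mul] at h
  linarith

/-- Young's inequality: a times the difference of the two sides is the form at au - v. -/
theorem quadForm_add_vec_le {A : Matrix (Fin d) (Fin d) ℝ} (hA : A.PosSemidef) {a : ℝ}
    (ha : 0 < a) (u v : EuclideanSpace ℝ (Fin d)) :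
    quadForm A (u + v) ≤ (1 + a) * quadForm A u + (1 + 1 / a) * quadForm A v := by
  have h := quadForm_nonneg hA (a • u - v)
  have key : a * ((1 + a) * quadForm A u + (1 + 1 / a) * quadForm A v - quadForm A (u + v))
      = quadForm A (a • u - v) := by
    simp [quadForm, mulVec_add, mulVec_sub, mulVec_smul]
    field_simp
    ring
  nlinarith [(mul_nonneg_iff_of_pos_left ha).1 (key ▸ h)]

/-- Cauchy–Schwarz on the diagonal; by symmetry the off-diagonal entries only add squares to tr A².
-/
theorem trace_sq_le {A : Matrix (Fin d) (Fin d) ℝ} (hA : A.IsSymm) :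
    A.trace ^ 2 ≤ d * (A * A).trace := by
  have h := sq_sum_le_card_mul_sum_sq (s := Finset.univ) (f := fun i => A i i)
  simp only [Finset.card_univ, Fintype.card_fin] at h
  refine h.trans (mul_le_mul_of_nonneg_left ?_ (Nat.cast_nonneg d))
  refine Finset.sum_le_sum fun i _ => ?_
  rw [diag_apply, mul_apply]
  refine le_trans (by simp [pow_two])
    (Finset.single_le_sum (f := fun j => A i j * A j i) (fun j _ => ?_) (Finset.mem_univ i))
  rw [hA.apply]; exact mul_self_nonneg _

theorem PosSemidef.isSymm {A : Matrix (Fin d) (Fin d) ℝ} (hA : A.PosSemidef) : A.IsSymm := by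
  simpa [IsHermitian, IsSymm] using hA.isHermitian

variable {Ω : Type*} [MeasurableSpace Ω]

/-- The entrywise expectation of a random matrix. -/
noncomputable def matrixMean (P : Measure Ω) (F : Ω → Matrix (Fin d) (Fin d) ℝ) :
    Matrix (Fin d) (Fin d) ℝ :=
  Matrix.of fun i j => ∫ ω, F ω i j ∂P

theorem trace_mul_matrixMean {P : Measure Ω} {F : Ω → Matrix (Fin d) (Fin d) ℝ}
    (hF : ∀ i j, Integrable (fun ω => F ω i j) P) (B : Matrix (Fin d) (Fin d) ℝ) :
    (B * matrixMean P F).trace = ∫ ω, (B * F ω).trace ∂P := by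
  have hF' : ∀ i j, Integrable (fun ω => B i j * F ω j i) P := fun i j => (hF j i).const_mul _
  simp only [Matrix.trace, diag_apply, mul_apply, matrixMean, of_apply]
  rw [integral_finsetSum _ fun i _ => integrable_finsetSum _ fun j _ => hF' i j]
  refine Finset.sum_congr rfl fun i _ => ?_
  rw [integral_finsetSum _ fun j _ => hF' i j]
  exact Finset.sum_congr rfl fun j _ => (integral_const_mul _ _).symm

/-- The matrix `1 - η x xᵀ` of the noiseless update. -/
def updateMat (η : ℝ) (x : EuclideanSpace ℝ (Fin d)) : Matrix (Fin d) (Fin d) ℝ :=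
  1 - η • vecMulVec x.ofLp x.ofLp

theorem updateMat_mulVec (η : ℝ) (x v : EuclideanSpace ℝ (Fin d)) :
    updateMat η x *ᵥ v.ofLp = (v - (η * ⟪v, x⟫) • x).ofLp := by
  have h1 : (⟪v, x⟫ : ℝ) = x.ofLp ⬝ᵥ v.ofLp := by simp [PiLp.inner_apply, dotProduct]
  simp [updateMat, sub_mulVec, smul_mulVec, vecMulVec_mulVec, h1, smul_smul]

theorem updateMat_transpose (η : ℝ) (x : EuclideanSpace ℝ (Fin d)) :
    (updateMat η x)ᵀ = updateMat η x := by
  simp [updateMat, transpose_sub, transpose_smul, transpose_vecMulVec]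

theorem continuous_updateMat (η : ℝ) :
    Continuous (updateMat η : EuclideanSpace ℝ (Fin d) → Matrix (Fin d) (Fin d) ℝ) := by
  unfold updateMat
  refine continuous_const.sub (Continuous.const_smul ?_ η)
  exact Continuous.matrix_vecMulVec (by fun_prop) (by fun_prop)

/-- The action `A ↦ E[(1 - η X Xᵀ) A (1 - η X Xᵀ)]` of one update on quadratic forms. -/
noncomputable def transfer (P : Measure Ω) (X : Ω → EuclideanSpace ℝ (Fin d)) (η : ℝ)
    (A : Matrix (Fin d) (Fin d) ℝ) : Matrix (Fin d) (Fin d) ℝ :=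
  matrixMean P fun ω => updateMat η (X ω) * A * updateMat η (X ω)

variable {P : Measure Ω} [IsProbabilityMeasure P] {X : Ω → EuclideanSpace ℝ (Fin d)} {R : ℝ}

theorem integrable_transfer (hX : Measurable X) (hR : ∀ᵐ ω ∂P, ‖X ω‖ ≤ R) (η : ℝ)
    (A : Matrix (Fin d) (Fin d) ℝ) (i j : Fin d) :
    Integrable (fun ω => (updateMat η (X ω) * A * updateMat η (X ω)) i j) P := by
  refine integrable_continuous_comp_of_bounded (f := fun x => (updateMat η x * A * updateMat η x) i j) hX hR ?_
  have := continuous_updateMat (d := d) η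
  exact (((this.matrix_mul continuous_const).matrix_mul this)).matrix_elem i j

theorem integrable_outer (hX : Measurable X) (hR : ∀ᵐ ω ∂P, ‖X ω‖ ≤ R) (i j : Fin d) :
    Integrable (fun ω => vecMulVec (X ω).ofLp (X ω).ofLp i j) P := by
  refine integrable_continuous_comp_of_bounded
    (f := fun x : EuclideanSpace ℝ (Fin d) => vecMulVec x.ofLp x.ofLp i j) hX hR ?_
  simp only [vecMulVec_apply]
  fun_prop

theorem quadForm_transfer (hX : Measurable X) (hR : ∀ᵐ ω ∂P, ‖X ω‖ ≤ R) (η : ℝ)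
    (A : Matrix (Fin d) (Fin d) ℝ) (v : EuclideanSpace ℝ (Fin d)) :
    quadForm (transfer P X η A) v = ∫ ω, quadForm A (v - (η * ⟪v, X ω⟫) • X ω) ∂P := by
  rw [quadForm_eq_trace, transfer, trace_mul_matrixMean (integrable_transfer hX hR η A)]
  refine integral_congr_ae (.of_forall fun ω => ?_)
  simp only
  rw [← quadForm_eq_trace, quadForm, quadForm, ← updateMat_mulVec, ← mulVec_mulVec, ← mulVec_mulVec,
    dotProduct_mulVec, ← mulVec_transpose, updateMat_transpose]

theorem transfer_posSemidef (hX : Measurable X) (hR : ∀ᵐ ω ∂P, ‖X ω‖ ≤ R) (η : ℝ)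
    {A : Matrix (Fin d) (Fin d) ℝ} (hA : A.PosSemidef) : (transfer P X η A).PosSemidef := by
  refine PosSemidef.of_dotProduct_mulVec_nonneg ?_ fun v => ?_
  · ext i j
    simp only [transfer, matrixMean, conjTranspose_apply, of_apply, star_trivial]
    congr 1 with ω
    have : (updateMat η (X ω) * A * updateMat η (X ω))ᵀ
        = updateMat η (X ω) * A * updateMat η (X ω) := by
      rw [transpose_mul, transpose_mul, updateMat_transpose, (PosSemidef.isSymm hA).eq,
        Matrix.mul_assoc]
    conv_rhs => rw [← this]
    rfl
  · have := quadForm_transfer hX hR η A (WithLp.toLp 2 v)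
    rw [star_trivial]
    change 0 ≤ quadForm (transfer P X η A) (WithLp.toLp 2 v)
    rw [this]
    exact integral_nonneg fun ω => quadForm_nonneg hA _

theorem transfer_linear (hX : Measurable X) (hR : ∀ᵐ ω ∂P, ‖X ω‖ ≤ R) (η : ℝ)
    (A B : Matrix (Fin d) (Fin d) ℝ) :
    transfer P X η (A + B) = transfer P X η A + transfer P X η B := by
  ext i j
  simp only [transfer, matrixMean, of_apply, Matrix.add_apply, Matrix.mul_add, Matrix.add_mul]
  exact integral_add (integrable_transfer hX hR η A i j) (integrable_transfer hX hR η B i j)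

/-- Cyclicity makes the two cross terms equal, and the rank-one factors turn the quartic term into
(XᵀAX)². This is where the functional defining `etaMax` enters. -/
theorem trace_mul_transfer (hX : Measurable X) (hR : ∀ᵐ ω ∂P, ‖X ω‖ ≤ R) (η : ℝ)
    {A : Matrix (Fin d) (Fin d) ℝ} (hA : A.IsSymm) :
    (A * transfer P X η A).trace = (A * A).trace
      - 2 * η * (Aᵀ * matrixMean P (fun ω => vecMulVec (X ω).ofLp (X ω).ofLp) * A).trace
      + η ^ 2 * ∫ ω, quadForm A (X ω) ^ 2 ∂P := by
  have h1 : (Aᵀ * matrixMean P (fun ω => vecMulVec (X ω).ofLp (X ω).ofLp) * A).trace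
      = ∫ ω, quadForm (A * A) (X ω) ∂P := by
    rw [Matrix.trace_mul_comm, ← Matrix.mul_assoc, hA.eq,
      trace_mul_matrixMean (integrable_outer hX hR)]
    simp only [quadForm_eq_trace]
    exact integral_congr_ae (.of_forall fun ω => Matrix.trace_mul_comm _ _)
  have i1 : Integrable (fun ω => quadForm (A * A) (X ω)) P :=
    integrable_continuous_comp_of_bounded hX hR (continuous_quadForm _)
  have i2 : Integrable (fun ω => quadForm A (X ω) ^ 2) P :=
    integrable_continuous_comp_of_bounded hX hR ((continuous_quadForm A).pow 2)
  rw [h1, transfer, trace_mul_matrixMean (integrable_transfer hX hR η A), ← integral_const_mul,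
    ← integral_const_mul]
  have i0 : Integrable (fun _ : Ω => (A * A).trace) P := integrable_const _
  have : (A * A).trace = ∫ _, (A * A).trace ∂P := by simp
  have i01 : Integrable (fun ω => (A * A).trace - 2 * η * quadForm (A * A) (X ω)) P :=
    i0.sub (i1.const_mul _)
  rw [this, ← integral_sub i0 (i1.const_mul _), ← integral_add i01 (i2.const_mul _)]
  refine integral_congr_ae (.of_forall fun ω => ?_)
  beta_reduce
  generalize X ω = x
  have e1 : (A * (vecMulVec x.ofLp x.ofLp * A)).trace = quadForm (A * A) x := by
    rw [quadForm_eq_trace, Matrix.trace_mul_comm, Matrix.mul_assoc]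
  have e2 : (A * (A * vecMulVec x.ofLp x.ofLp)).trace = quadForm (A * A) x := by
    rw [quadForm_eq_trace, ← Matrix.mul_assoc, Matrix.trace_mul_comm]
  have e3 : (A * (vecMulVec x.ofLp x.ofLp * (A * vecMulVec x.ofLp x.ofLp))).trace
      = quadForm A x ^ 2 := by
    rw [mul_vecMulVec, vecMulVec_mul_vecMulVec, vecMulVec_smul, Matrix.mul_smul, mul_vecMulVec]
    simp only [trace_smul, trace_vecMulVec, smul_eq_mul]
    rw [dotProduct_comm (A *ᵥ _), quadForm, pow_two]
  simp only [updateMat, Matrix.mul_sub, Matrix.sub_mul, Matrix.mul_one, Matrix.one_mul,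
    Matrix.smul_mul, Matrix.mul_smul, trace_sub, trace_smul, smul_eq_mul, Matrix.mul_assoc, e1, e2, e3]
  ring

/-- Under the step-size condition there is a positive semidefinite quadratic form that the noiseless
update decreases in mean by a multiple of the squared norm. -/
theorem exists_lyapunov (hX : Measurable X) (hR : ∀ᵐ ω ∂P, ‖X ω‖ ≤ R) {η lam : ℝ} (hη : 0 < η)
    (hlam : 0 < lam)
    (hH : (matrixMean P (fun ω => vecMulVec (X ω).ofLp (X ω).ofLp) - lam • 1).PosSemidef)
    (hgap : ∀ A : Matrix (Fin d) (Fin d) ℝ, A.IsSymm → η * ∫ ω, quadForm A (X ω) ^ 2 ∂P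
      ≤ (Aᵀ * matrixMean P (fun ω => vecMulVec (X ω).ofLp (X ω).ofLp) * A).trace) :
    ∃ Q : Matrix (Fin d) (Fin d) ℝ, Q.PosSemidef ∧ (∀ v, η * ‖v‖ ^ 2 ≤ quadForm Q v) ∧
      ∀ v, ∫ ω, quadForm Q (v - (η * ⟪v, X ω⟫) • X ω) ∂P ≤ quadForm Q v - η / 2 * ‖v‖ ^ 2 := by
  set T := transfer P X η with hT
  have hpow : ∀ k, ((T^[k]) 1).PosSemidef := fun k => by
    induction k with
    | zero => exact PosSemidef.one
    | succ k ih => rw [Function.iterate_succ_apply']; exact transfer_posSemidef hX hR η ih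
  let S : ℕ → Matrix (Fin d) (Fin d) ℝ := fun N => ∑ k ∈ Finset.range N, (T^[k]) 1
  have hS : ∀ N, (S N).PosSemidef := fun N => posSemidef_sum _ fun k _ => hpow k
  have hT0 : T 0 = 0 := by
    have := transfer_linear (P := P) (X := X) hX hR η 0 0
    simpa [hT] using this
  -- Telescoping: `T` shifts the partial sum by one term.
  have htel : ∀ N, T (S N) = S N + (T^[N]) 1 - 1 := fun N => by
    induction N with
    | zero => simp [S, hT0]
    | succ N ih =>
      have e : S (N + 1) = S N + (T^[N]) 1 := Finset.sum_range_succ _ _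
      rw [e, hT, transfer_linear hX hR, ← hT, ih, Function.iterate_succ_apply']
      abel
  -- Write S for `S N`. Comparing the two expressions for tr(S T(S)) and dropping tr(S Tᴺ(1)) ≥ 0
  -- gives ηλ tr S² ≤ η tr(SHS) ≤ tr S. With (tr S)² ≤ d tr S² this bounds tr S independently of N.
  have hbound : ∀ N, (S N).trace ≤ d / (η * lam) := fun N => by
    have hsym := PosSemidef.isSymm (hS N)
    have h1 := trace_mul_transfer (P := P) hX hR η hsym
    rw [← hT, htel, Matrix.mul_sub, Matrix.mul_add, Matrix.mul_one, trace_sub, trace_add] at h1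
    have h2 := PosSemidef.trace_mul_nonneg (hS N) (hpow N)
    have h3 := mul_le_mul_of_nonneg_left (hgap _ hsym) hη.le
    have h4 := (hH.conjTranspose_mul_mul_same (S N)).trace_nonneg
    rw [conjTranspose_eq_transpose_of_trivial, Matrix.mul_sub, Matrix.sub_mul, trace_sub,
      Matrix.mul_smul, Matrix.mul_one, Matrix.smul_mul, trace_smul, smul_eq_mul] at h4
    have h4' : ((S N)ᵀ * S N).trace = (S N * S N).trace := by rw [hsym.eq]
    rw [h4'] at h4
    have h5 := trace_sq_le hsym
    have h6 := (hS N).trace_nonneg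
    have h7 : η * lam * (S N * S N).trace ≤ (S N).trace := by nlinarith
    rcases h6.eq_or_lt with h0 | h0
    · rw [← h0]; positivity
    · rw [le_div_iff₀ (by positivity)]
      have h8 : η * lam * (S N).trace ^ 2 ≤ d * (S N).trace := by
        have hd : (0 : ℝ) ≤ d := Nat.cast_nonneg d
        calc η * lam * (S N).trace ^ 2 ≤ η * lam * (d * (S N * S N).trace) := by gcongr
          _ = d * (η * lam * (S N * S N).trace) := by ring
          _ ≤ d * (S N).trace := by gcongr
      nlinarith
  -- Bounded partial sums of nonnegative traces force some term to be small. `1 ≤ N` keeps the k = 0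
  -- term, the identity, in `S N`; it supplies the lower bound on Q.
  obtain ⟨N, hN, hN1⟩ : ∃ N, 1 ≤ N ∧ ((T^[N]) 1).trace ≤ 1 / 2 := by
    by_contra! hcon
    obtain ⟨M, hM⟩ := exists_nat_gt (2 * (d / (η * lam)))
    have h1 : (M : ℝ) / 2 ≤ (S (M + 1)).trace := by
      simp only [S, trace_sum]
      rw [Finset.sum_range_succ']
      refine le_add_of_le_of_nonneg ?_ (hpow 0).trace_nonneg
      have := Finset.card_nsmul_le_sum (Finset.range M) (fun k => ((T^[k + 1]) 1).trace) (1 / 2)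
        fun k _ => (hcon (k + 1) (by lia)).le
      simpa [div_eq_mul_inv] using this
    linarith [hbound (M + 1)]
  -- By telescoping, Q - T(Q) = η(1 - Tᴺ(1)), which is at least η/2 because Tᴺ(1) is dominated by
  -- its trace.
  refine ⟨η • S N, (hS N).smul hη.le, fun v => ?_, fun v => ?_⟩
  · obtain ⟨M, rfl⟩ : ∃ M, N = M + 1 := ⟨N - 1, by lia⟩
    rw [quadForm_smul]
    gcongr
    have : S (M + 1) = ∑ k ∈ Finset.range M, (T^[k + 1]) 1 + 1 := by
      simp only [S]; rw [Finset.sum_range_succ']; rfl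
    rw [this, quadForm_add, quadForm_one]
    exact le_add_of_nonneg_left (quadForm_nonneg (posSemidef_sum _ fun k _ => hpow _) v)
  · simp_rw [quadForm_smul]
    rw [integral_const_mul, ← quadForm_transfer hX hR, ← hT, htel, quadForm_sub, quadForm_add,
      quadForm_one]
    have h1 := quadForm_le_trace_mul (hpow N) v
    have h2 : ((T^[N]) 1).trace * ‖v‖ ^ 2 ≤ 1 / 2 * ‖v‖ ^ 2 := by gcongr
    nlinarith

end Matrix

/-! ### One noisy update: centred increments and drift -/

section OneStep

/-- Shifting by the mean, expand |(U - m) + ζ|². It yields both the orthogonality of martingale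
increments and, at U = 0, the variance identity. -/
theorem integral_norm_add_centered_sq {Ω E : Type*} [MeasurableSpace Ω]
    [NormedAddCommGroup E] [InnerProductSpace ℝ E] [CompleteSpace E]
    {P : Measure Ω} [IsProbabilityMeasure P] {ζ : Ω → E} (hζ : MemLp ζ 2 P) (U : E) :
    ∫ ω, ‖U + (ζ ω - ∫ ω', ζ ω' ∂P)‖ ^ 2 ∂P
      = ‖U‖ ^ 2 - ‖∫ ω, ζ ω ∂P‖ ^ 2 + ∫ ω, ‖ζ ω‖ ^ 2 ∂P := by
  set m := ∫ ω', ζ ω' ∂P with hm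
  have hi : Integrable ζ P := hζ.integrable one_le_two
  have h2 : Integrable (fun ω => ‖ζ ω‖ ^ 2) P := hζ.integrable_norm_pow (by norm_num)
  have h1 : Integrable (fun ω => 2 * ⟪U - m, ζ ω⟫) P := (hi.const_inner _).const_mul 2
  have h0 : Integrable (fun _ : Ω => ‖U - m‖ ^ 2) P := integrable_const _
  have h01 : Integrable (fun ω => ‖U - m‖ ^ 2 + 2 * ⟪U - m, ζ ω⟫) P := h0.add h1
  have e : ∀ ω, ‖U + (ζ ω - m)‖ ^ 2 = ‖U - m‖ ^ 2 + 2 * ⟪U - m, ζ ω⟫ + ‖ζ ω‖ ^ 2 := fun ω => by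
    rw [← norm_add_sq_real]; congr 2; abel
  simp_rw [e]
  rw [integral_add h01 h2, integral_add h0 h1, integral_const_mul, integral_inner hi, ← hm,
    norm_sub_sq_real, inner_sub_left, real_inner_self_eq_norm_sq]
  simp only [integral_const, probReal_univ, one_smul]
  ring

variable {d : ℕ} {Ω : Type*} [MeasurableSpace Ω] {P : Measure Ω} [IsProbabilityMeasure P]
  {X : Ω → EuclideanSpace ℝ (Fin d)} {R : ℝ}

theorem integrable_inner_smul (hX : Measurable X) (hR : ∀ᵐ ω ∂P, ‖X ω‖ ≤ R)
    (v : EuclideanSpace ℝ (Fin d)) : Integrable (fun ω => ⟪v, X ω⟫ • X ω) P :=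
  integrable_continuous_comp_of_bounded (f := fun x => ⟪v, x⟫ • x) hX hR (by fun_prop)

/-- The second moment operator `v ↦ E[⟨v, X⟩ X]`. -/
noncomputable def momentOp (P : Measure Ω) (X : Ω → EuclideanSpace ℝ (Fin d))
    (v : EuclideanSpace ℝ (Fin d)) : EuclideanSpace ℝ (Fin d) :=
  ∫ ω, ⟪v, X ω⟫ • X ω ∂P

theorem momentOp_add (hX : Measurable X) (hR : ∀ᵐ ω ∂P, ‖X ω‖ ≤ R)
    (u v : EuclideanSpace ℝ (Fin d)) :
    momentOp P X (u + v) = momentOp P X u + momentOp P X v := by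
  simp only [momentOp, inner_add_left, add_smul]
  exact integral_add (integrable_inner_smul hX hR u) (integrable_inner_smul hX hR v)

theorem inner_momentOp (hX : Measurable X) (hR : ∀ᵐ ω ∂P, ‖X ω‖ ≤ R)
    (v : EuclideanSpace ℝ (Fin d)) : ⟪v, momentOp P X v⟫ = ∫ ω, ⟪v, X ω⟫ ^ 2 ∂P := by
  rw [momentOp, ← integral_inner (integrable_inner_smul hX hR v)]
  simp [inner_smul_right, pow_two]

theorem le_integral_inner_sq (hX : Measurable X) (hR : ∀ᵐ ω ∂P, ‖X ω‖ ≤ R) {lam : ℝ}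
    (hH : (matrixMean P (fun ω => Matrix.vecMulVec (X ω).ofLp (X ω).ofLp) - lam • 1).PosSemidef)
    (v : EuclideanSpace ℝ (Fin d)) : lam * ‖v‖ ^ 2 ≤ ∫ ω, ⟪v, X ω⟫ ^ 2 ∂P := by
  have h := quadForm_nonneg hH v
  rw [quadForm_sub, quadForm_smul, quadForm_one, quadForm_eq_trace,
    trace_mul_matrixMean (integrable_outer hX hR)] at h
  refine (sub_nonneg.1 h).trans (le_of_eq (integral_congr_ae (.of_forall fun ω => ?_)))
  have h1 : (⟪v, X ω⟫ : ℝ) = (X ω).ofLp ⬝ᵥ v.ofLp := by simp [PiLp.inner_apply, dotProduct]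
  simp only [Matrix.mul_vecMulVec, Matrix.vecMulVec_mulVec, Matrix.trace_vecMulVec]
  simp [h1, dotProduct_comm v.ofLp, pow_two]

theorem le_norm_momentOp (hX : Measurable X) (hR : ∀ᵐ ω ∂P, ‖X ω‖ ≤ R) {lam : ℝ}
    (hH : (matrixMean P (fun ω => Matrix.vecMulVec (X ω).ofLp (X ω).ofLp) - lam • 1).PosSemidef)
    (v : EuclideanSpace ℝ (Fin d)) : lam * ‖v‖ ≤ ‖momentOp P X v‖ := by
  rcases (norm_nonneg v).eq_or_lt with h0 | h0
  · simp [← h0]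
  · have h := (le_integral_inner_sq hX hR hH v).trans_eq (inner_momentOp hX hR v).symm
    have := h.trans (real_inner_le_norm _ _)
    nlinarith

/-- Nonnegativity of the variance of hX, with |X| ≤ R. It controls the bias caused by a wrong
nuisance. -/
theorem norm_integral_smul_sq_le (hX : Measurable X) (hR : ∀ᵐ ω ∂P, ‖X ω‖ ≤ R)
    {h : Ω → ℝ} (hh : MemLp h 2 P) :
    ‖∫ ω, h ω • X ω ∂P‖ ^ 2 ≤ R ^ 2 * ∫ ω, h ω ^ 2 ∂P := by
  have hXi : MemLp X ∞ P := memLp_top_of_bound hX.aestronglyMeasurable R hR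
  have hL : MemLp (fun ω => h ω • X ω) 2 P := hXi.smul hh
  have h2 : ∫ ω, ‖h ω • X ω‖ ^ 2 ∂P ≤ R ^ 2 * ∫ ω, h ω ^ 2 ∂P := by
    rw [← integral_const_mul]
    refine integral_mono_ae (hL.integrable_norm_pow (by norm_num)) (hh.integrable_sq.const_mul _) ?_
    filter_upwards [hR] with ω hω
    rw [norm_smul, mul_pow, Real.norm_eq_abs, sq_abs, mul_comm]
    gcongr
  have h3 : 0 ≤ ∫ ω, ‖(0 : EuclideanSpace ℝ (Fin d)) + (h ω • X ω - ∫ ω', h ω' • X ω' ∂P)‖ ^ 2 ∂P :=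
    integral_nonneg fun _ => by positivity
  rw [integral_norm_add_centered_sq hL 0] at h3
  simp only [norm_zero] at h3
  linarith

/-- The mean of the update increment. -/
theorem integral_increment (hX : Measurable X) (hR : ∀ᵐ ω ∂P, ‖X ω‖ ≤ R) (η : ℝ)
    {e : Ω → ℝ} (he : MemLp e 2 P) (δ : EuclideanSpace ℝ (Fin d)) :
    ∫ ω, (η * (e ω - ⟪δ, X ω⟫)) • X ω ∂P
      = η • ∫ ω, e ω • X ω ∂P - η • momentOp P X δ := by
  have hXi : MemLp X ∞ P := memLp_top_of_bound hX.aestronglyMeasurable R hR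
  have hL : MemLp (fun ω => e ω • X ω) 2 P := hXi.smul he
  simp_rw [mul_smul, sub_smul]
  rw [integral_smul, integral_sub (hL.integrable one_le_two) (integrable_inner_smul hX hR δ),
    smul_sub, momentOp]

/-- The mean square increase of the centred sum of increments in one step. -/
theorem lintegral_centered_step_le (hX : Measurable X) (hR : ∀ᵐ ω ∂P, ‖X ω‖ ≤ R) (η : ℝ)
    {e : Ω → ℝ} (he : MemLp e 2 P) (U δ : EuclideanSpace ℝ (Fin d)) :
    ∫⁻ ω, ‖U + ((η * (e ω - ⟪δ, X ω⟫)) • X ω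
        - ∫ ω', (η * (e ω' - ⟪δ, X ω'⟫)) • X ω' ∂P)‖ₑ ^ 2 ∂P
      ≤ ‖U‖ₑ ^ 2 + ENNReal.ofReal (2 * η ^ 2 * R ^ 4) * ‖δ‖ₑ ^ 2
        + ENNReal.ofReal (2 * η ^ 2 * R ^ 2 * ∫ ω, e ω ^ 2 ∂P) := by
  have hXi : MemLp X ∞ P := memLp_top_of_bound hX.aestronglyMeasurable R hR
  have hδ : MemLp (fun ω => ⟪δ, X ω⟫) 2 P :=
    (memLp_two_iff_integrable_sq (by fun_prop)).2
      (integrable_continuous_comp_of_bounded (f := fun x => ⟪δ, x⟫ ^ 2) hX hR (by fun_prop))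
  have hL : MemLp (fun ω => (η * (e ω - ⟪δ, X ω⟫)) • X ω) 2 P := hXi.smul ((he.sub hδ).const_mul η)
  set m := ∫ ω', (η * (e ω' - ⟪δ, X ω'⟫)) • X ω' ∂P with hm
  have h1 := integral_norm_add_centered_sq hL U
  rw [← hm] at h1
  have h2 : ∫ ω, ‖(η * (e ω - ⟪δ, X ω⟫)) • X ω‖ ^ 2 ∂P
      ≤ 2 * η ^ 2 * R ^ 2 * ∫ ω, e ω ^ 2 ∂P + 2 * η ^ 2 * R ^ 4 * ‖δ‖ ^ 2 := by
    have : ∫ ω, (2 * η ^ 2 * R ^ 2 * e ω ^ 2 + 2 * η ^ 2 * R ^ 4 * ‖δ‖ ^ 2) ∂P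
        = 2 * η ^ 2 * R ^ 2 * ∫ ω, e ω ^ 2 ∂P + 2 * η ^ 2 * R ^ 4 * ‖δ‖ ^ 2 := by
      rw [integral_add (he.integrable_sq.const_mul _) (integrable_const _), integral_const_mul]
      simp
    rw [← this]
    refine integral_mono_ae (hL.integrable_norm_pow (by norm_num))
      ((he.integrable_sq.const_mul _).add (integrable_const _)) ?_
    filter_upwards [hR] with ω hω
    have hi : ⟪δ, X ω⟫ ^ 2 ≤ R ^ 2 * ‖δ‖ ^ 2 := by
      rw [← sq_abs, ← mul_pow, mul_comm]
      gcongr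
      exact (abs_real_inner_le_norm _ _).trans (by gcongr)
    rw [norm_smul, mul_pow, Real.norm_eq_abs, sq_abs]
    calc (η * (e ω - ⟪δ, X ω⟫)) ^ 2 * ‖X ω‖ ^ 2
        ≤ (η ^ 2 * (2 * e ω ^ 2 + 2 * (R ^ 2 * ‖δ‖ ^ 2))) * R ^ 2 := by
          rw [mul_pow]
          gcongr
          nlinarith [sq_nonneg (e ω + ⟪δ, X ω⟫)]
      _ = _ := by ring
  have hint : Integrable (fun ω => ‖U + ((η * (e ω - ⟪δ, X ω⟫)) • X ω - m)‖ ^ 2) P :=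
    ((memLp_const U).add (hL.sub (memLp_const m))).integrable_norm_pow (by norm_num)
  have e0 : ∀ v : EuclideanSpace ℝ (Fin d), ‖v‖ₑ ^ 2 = ENNReal.ofReal (‖v‖ ^ 2) := fun v => by
    rw [ENNReal.ofReal_pow (norm_nonneg _), ofReal_norm]
  have hR2 : 0 ≤ 2 * η ^ 2 * R ^ 4 := by positivity
  have he2 : 0 ≤ ∫ ω, e ω ^ 2 ∂P := integral_nonneg fun _ => sq_nonneg _
  simp_rw [e0]
  rw [← ofReal_integral_eq_lintegral_ofReal hint (.of_forall fun _ => by positivity),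
    ← ENNReal.ofReal_mul hR2, ← ENNReal.ofReal_add (by positivity) (by positivity),
    ← ENNReal.ofReal_add (by positivity) (by positivity)]
  -- The squared mean enters the variance identity with a minus sign and is discarded.
  exact ENNReal.ofReal_le_ofReal (by nlinarith [sq_nonneg ‖m‖])

/-- Geometric drift of the Lyapunov function in one step of the noisy update. -/
theorem exists_drift (hX : Measurable X) (hR : ∀ᵐ ω ∂P, ‖X ω‖ ≤ R) {η : ℝ} (hη : 0 < η)
    {Q : Matrix (Fin d) (Fin d) ℝ} (hQ : Q.PosSemidef)
    (hdec : ∀ v, ∫ ω, quadForm Q (v - (η * ⟪v, X ω⟫) • X ω) ∂P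
      ≤ quadForm Q v - η / 2 * ‖v‖ ^ 2) :
    ∃ r K : ℝ≥0, r < 1 ∧ ∀ e : Ω → ℝ, MemLp e 2 P → ∀ δ,
      ∫⁻ ω, ENNReal.ofReal (quadForm Q (δ + (η * (e ω - ⟪δ, X ω⟫)) • X ω)) ∂P
        ≤ r * ENNReal.ofReal (quadForm Q δ) + K * ENNReal.ofReal (∫ ω, e ω ^ 2 ∂P) := by
  -- Adding η keeps B positive even if Q has trace zero, and makes a ≤ 1/2.
  set B := Q.trace + η with hB
  have hB0 : 0 < B := by have := hQ.trace_nonneg; positivity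
  set a := η / (2 * B) with ha
  have ha0 : 0 < a := by positivity
  have ha1 : a < 1 := by
    have := hQ.trace_nonneg
    rw [ha, div_lt_one (by positivity)]; linarith
  have hr : 0 ≤ 1 - a ^ 2 := by nlinarith
  have hK' : 0 ≤ (1 + 1 / a) * (η ^ 2 * (Q.trace * R ^ 2)) := by
    have := hQ.trace_nonneg
    positivity
  refine ⟨.mk (1 - a ^ 2) hr, .mk _ hK', ?_, fun e he δ => ?_⟩
  · rw [← NNReal.coe_lt_coe]; change 1 - a ^ 2 < 1; nlinarith
  have hu : Integrable (fun ω => quadForm Q (δ - (η * ⟪δ, X ω⟫) • X ω)) P :=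
    integrable_continuous_comp_of_bounded (f := fun x => quadForm Q (δ - (η * ⟪δ, x⟫) • x)) hX hR
      ((continuous_quadForm Q).comp (by fun_prop))
  have hδ : 0 ≤ quadForm Q δ := quadForm_nonneg hQ δ
  have he2 : 0 ≤ ∫ ω, e ω ^ 2 ∂P := integral_nonneg fun _ => sq_nonneg _
  -- The update is the noiseless one plus ηeX. Young's inequality with weight a separates them, so e
  -- need not be centred.
  have hpt : ∀ᵐ ω ∂P, quadForm Q (δ + (η * (e ω - ⟪δ, X ω⟫)) • X ω)
      ≤ (1 + a) * quadForm Q (δ - (η * ⟪δ, X ω⟫) • X ω)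
        + (1 + 1 / a) * (η ^ 2 * (Q.trace * R ^ 2)) * e ω ^ 2 := by
    filter_upwards [hR] with ω hω
    have h1 : δ + (η * (e ω - ⟪δ, X ω⟫)) • X ω
        = (δ - (η * ⟪δ, X ω⟫) • X ω) + (η * e ω) • X ω := by module
    rw [h1]
    refine (quadForm_add_vec_le hQ ha0 _ _).trans ?_
    rw [quadForm_smul_vec]
    have h2 : quadForm Q (X ω) ≤ Q.trace * R ^ 2 :=
      (quadForm_le_trace_mul hQ _).trans (by have := hQ.trace_nonneg; gcongr)
    have h3 : (1 + 1 / a) * ((η * e ω) ^ 2 * quadForm Q (X ω))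
        ≤ (1 + 1 / a) * ((η * e ω) ^ 2 * (Q.trace * R ^ 2)) := by gcongr
    linarith
  -- The choice a = η/(2B) turns the decrease η|δ|²/2 into at least aQ(δ), so the factor is (1 +
  -- a)(1 - a).
  have hbd : (1 + a) * (quadForm Q δ - η / 2 * ‖δ‖ ^ 2) ≤ (1 - a ^ 2) * quadForm Q δ := by
    have h1 : quadForm Q δ ≤ B * ‖δ‖ ^ 2 :=
      (quadForm_le_trace_mul hQ δ).trans (by gcongr; linarith)
    have h2 : a * quadForm Q δ ≤ η / 2 * ‖δ‖ ^ 2 := by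
      calc a * quadForm Q δ ≤ a * (B * ‖δ‖ ^ 2) := by gcongr
        _ = η / 2 * ‖δ‖ ^ 2 := by rw [ha]; field_simp
    nlinarith
  calc ∫⁻ ω, ENNReal.ofReal (quadForm Q (δ + (η * (e ω - ⟪δ, X ω⟫)) • X ω)) ∂P
      ≤ ∫⁻ ω, ENNReal.ofReal ((1 + a) * quadForm Q (δ - (η * ⟪δ, X ω⟫) • X ω)
        + (1 + 1 / a) * (η ^ 2 * (Q.trace * R ^ 2)) * e ω ^ 2) ∂P :=
        lintegral_mono_ae (hpt.mono fun _ h => ENNReal.ofReal_le_ofReal h)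
    _ = ENNReal.ofReal ((1 + a) * ∫ ω, quadForm Q (δ - (η * ⟪δ, X ω⟫) • X ω) ∂P
        + (1 + 1 / a) * (η ^ 2 * (Q.trace * R ^ 2)) * ∫ ω, e ω ^ 2 ∂P) := by
        have hi : Integrable (fun ω => (1 + a) * quadForm Q (δ - (η * ⟪δ, X ω⟫) • X ω)
            + (1 + 1 / a) * (η ^ 2 * (Q.trace * R ^ 2)) * e ω ^ 2) P :=
          (hu.const_mul _).add (he.integrable_sq.const_mul _)
        rw [← ofReal_integral_eq_lintegral_ofReal hi (.of_forall fun ω =>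
              add_nonneg (mul_nonneg (by positivity) (quadForm_nonneg hQ _))
                (mul_nonneg hK' (sq_nonneg _))),
          integral_add (hu.const_mul _) (he.integrable_sq.const_mul _), integral_const_mul,
          integral_const_mul]
    _ ≤ ENNReal.ofReal ((1 - a ^ 2) * quadForm Q δ
        + (1 + 1 / a) * (η ^ 2 * (Q.trace * R ^ 2)) * ∫ ω, e ω ^ 2 ∂P) := by
        refine ENNReal.ofReal_le_ofReal (add_le_add_left (le_trans ?_ hbd) _)
        exact mul_le_mul_of_nonneg_left (hdec δ) (by positivity)
    _ = _ := by
        rw [ENNReal.ofReal_add (mul_nonneg hr hδ) (mul_nonneg hK' he2), ENNReal.ofReal_mul hr,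
          ENNReal.ofReal_mul hK', ENNReal.ofReal_eq_coe_nnreal hr, ENNReal.ofReal_eq_coe_nnreal hK']

end OneStep

/-! ### Error recursion, measurability and the martingale of increments -/

section Iterates

variable {d : ℕ} {𝒲 : Type*}

theorem sgd_congr {η : ℝ} {θinit : EuclideanSpace ℝ (Fin d)} {g : 𝒲 → ℝ} {z z' : ℕ → Obs d 𝒲}
    {t : ℕ} (h : ∀ i ∈ Finset.Icc 1 t, z i = z' i) :
    sgd η θinit g z t = sgd η θinit g z' t := by
  induction t with
  | zero => rfl
  | succ t ih =>
    have h1 := ih fun i hi => h i (by simp at hi ⊢; lia)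
    rw [sgd, sgd, h1, h (t + 1) (by simp)]

theorem avgSGD_congr {η : ℝ} {θinit : EuclideanSpace ℝ (Fin d)} {g : 𝒲 → ℝ} {z z' : ℕ → Obs d 𝒲}
    {n : ℕ} (h : ∀ i ∈ Finset.Icc 1 n, z i = z' i) :
    avgSGD η θinit g z n = avgSGD η θinit g z' n := by
  rw [avgSGD, avgSGD]
  congr 1
  refine Finset.sum_congr rfl fun t ht => sgd_congr fun i hi => h i ?_
  simp at hi ht ⊢; lia

/-- Centring at an arbitrary θ₀ puts all nuisance error into the residual; the recursion is affine
in the error. -/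
theorem sgd_succ_sub (η : ℝ) (θinit θ₀ : EuclideanSpace ℝ (Fin d)) (g : 𝒲 → ℝ)
    (z : ℕ → Obs d 𝒲) (t : ℕ) :
    sgd η θinit g z (t + 1) - θ₀ = (sgd η θinit g z t - θ₀)
      + (η * (residual θ₀ g (z (t + 1)) - ⟪sgd η θinit g z t - θ₀, (z (t + 1)).1⟫))
        • (z (t + 1)).1 := by
  rw [sgd, score_eq, residual, inner_sub_left]
  module

variable [MeasurableSpace 𝒲]

theorem measurable_sgd {α : Type*} [MeasurableSpace α] {G : α → 𝒲 → ℝ}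
    (hG : Measurable (Function.uncurry G)) {z : α → ℕ → Obs d 𝒲} (hz : ∀ i, Measurable fun a => z a i)
    (η : ℝ) (θinit : EuclideanSpace ℝ (Fin d)) (t : ℕ) :
    Measurable fun a => sgd η θinit (G a) (z a) t := by
  induction t with
  | zero => exact measurable_const
  | succ t ih =>
    simp only [sgd, score_eq]
    have h1 : Measurable fun a => G a (z a (t + 1)).2.1 :=
      hG.comp (measurable_id.prodMk (hz (t + 1)).snd.fst)
    have h2 : Measurable fun a => (z a (t + 1)).2.2 := (hz (t + 1)).snd.snd
    have h3 : Measurable fun a => (z a (t + 1)).1 := (hz (t + 1)).fst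
    fun_prop

theorem measurable_avgSGD {α : Type*} [MeasurableSpace α] {G : α → 𝒲 → ℝ}
    (hG : Measurable (Function.uncurry G)) {z : α → ℕ → Obs d 𝒲} (hz : ∀ i, Measurable fun a => z a i)
    (η : ℝ) (θinit : EuclideanSpace ℝ (Fin d)) (n : ℕ) :
    Measurable fun a => avgSGD η θinit (G a) (z a) n := by
  have h : Measurable fun a => ∑ t ∈ Finset.range n, sgd η θinit (G a) (z a) t :=
    Finset.measurable_fun_sum _ fun t _ => measurable_sgd hG hz η θinit t
  exact h.const_smul (1 / (n : ℝ))

theorem measurable_residual (θ₀ : EuclideanSpace ℝ (Fin d)) {g : 𝒲 → ℝ} (hg : Measurable g) :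
    Measurable (residual θ₀ g : Obs d 𝒲 → ℝ) := by
  unfold residual
  have h1 : Measurable fun z : Obs d 𝒲 => g z.2.1 := hg.comp measurable_snd.fst
  have h2 : Measurable fun z : Obs d 𝒲 => z.2.2 := measurable_snd.snd
  have h3 : Measurable fun z : Obs d 𝒲 => z.1 := measurable_fst
  fun_prop

theorem measurable_momentOp {Ω : Type*} [MeasurableSpace Ω] {P : Measure Ω} [SFinite P]
    {X : Ω → EuclideanSpace ℝ (Fin d)} (hX : Measurable X) : Measurable (momentOp P X) := by
  have h : Measurable fun p : EuclideanSpace ℝ (Fin d) × Ω => ⟪p.1, X p.2⟫ • X p.2 := by fun_prop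
  exact (h.stronglyMeasurable.integral_prod_right (ν := P)).measurable

/-- Averaging over an observation that is independent of the past. -/
theorem lintegral_eq_of_indepFun {Ω S O : Type*} [MeasurableSpace Ω] [MeasurableSpace S]
    [MeasurableSpace O] {μ : Measure Ω} [IsProbabilityMeasure μ] {T : Ω → S} {Z : Ω → O}
    (hT : Measurable T) (hZ : Measurable Z) (h : IndepFun T Z μ) {f : S × O → ℝ≥0∞}
    (hf : Measurable f) :
    ∫⁻ ω, f (T ω, Z ω) ∂μ = ∫⁻ ω, ∫⁻ z, f (T ω, z) ∂(μ.map Z) ∂μ := by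
  have : IsProbabilityMeasure (μ.map Z) := Measure.isProbabilityMeasure_map hZ.aemeasurable
  have : IsProbabilityMeasure (μ.map T) := Measure.isProbabilityMeasure_map hT.aemeasurable
  rw [← lintegral_map hf (hT.prodMk hZ),
    (indepFun_iff_map_prod_eq_prod_map_map hT.aemeasurable hZ.aemeasurable).1 h,
    lintegral_prod _ hf.aemeasurable, lintegral_map hf.lintegral_prod_right' hT]

/-- A function of the first `t` observations is independent of the next one. -/
theorem IsSample.indepFun_prefix {Ω β : Type*} [MeasurableSpace Ω] [MeasurableSpace β]
    {μ : Measure Ω} {P : Measure (Obs d 𝒲)} [IsProbabilityMeasure P] {Z : ℕ → Ω → Obs d 𝒲} {n : ℕ}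
    (hs : IsSample μ P Z n) {t : ℕ} (ht : t + 1 ≤ n) {F : (ℕ → Obs d 𝒲) → β} (hF : Measurable F)
    (hdep : ∀ z z', (∀ i ∈ Finset.Icc 1 t, z i = z' i) → F z = F z') :
    IndepFun (fun ω => F (fun i => Z i ω)) (Z (t + 1)) μ := by
  classical
  obtain ⟨z0⟩ := nonempty_of_isProbabilityMeasure P
  have hlast : t + 1 ∈ Finset.Icc 1 n := by simp; lia
  let S : Finset (Finset.Icc 1 n) := Finset.univ.filter fun i => i.1 ≤ t
  let T : Finset (Finset.Icc 1 n) := {⟨t + 1, hlast⟩}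
  have hST : Disjoint S T := by
    rw [Finset.disjoint_singleton_right]
    simp [S]
  have h := hs.indep.indepFun_finset S T hST fun i => hs.measurable i.1 i.2
  -- Coordinates after t are filled with a fixed observation; `hdep` says that `F` ignores them.
  let ext : (S → Obs d 𝒲) → ℕ → Obs d 𝒲 := fun z i =>
    if hi : i ∈ Finset.Icc 1 n ∧ i ≤ t then z ⟨⟨i, hi.1⟩, by simp [S, hi.2]⟩ else z0
  have hext : Measurable ext := by
    refine measurable_pi_lambda _ fun i => ?_
    by_cases hi : i ∈ Finset.Icc 1 n ∧ i ≤ t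
    · simp only [ext, dif_pos hi]; exact measurable_pi_apply _
    · simp only [ext, dif_neg hi]; exact measurable_const
  have h2 := h.comp (hF.comp hext) (measurable_pi_apply (⟨⟨t + 1, hlast⟩, by simp [T]⟩ : T))
  refine h2.congr (.of_forall fun ω => ?_) (.of_forall fun ω => rfl)
  refine hdep _ _ fun i hi => ?_
  simp only [Finset.mem_Icc] at hi
  have hi' : i ∈ Finset.Icc 1 n ∧ i ≤ t := ⟨by simp; lia, hi.2⟩
  simp only [ext, dif_pos hi']

/-- The centred partial sum of the update increments. -/
noncomputable def fluctuation (P : Measure (Obs d 𝒲)) (η : ℝ) (θinit θ₀ : EuclideanSpace ℝ (Fin d))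
    (g : 𝒲 → ℝ) (z : ℕ → Obs d 𝒲) (t : ℕ) : EuclideanSpace ℝ (Fin d) :=
  (sgd η θinit g z t - θ₀)
    + η • momentOp P Prod.fst (∑ j ∈ Finset.range t, (sgd η θinit g z j - θ₀))
    - (t * η) • ∫ z, residual θ₀ g z • z.1 ∂P

theorem fluctuation_congr {P : Measure (Obs d 𝒲)} {η : ℝ} {θinit θ₀ : EuclideanSpace ℝ (Fin d)}
    {g : 𝒲 → ℝ} {z z' : ℕ → Obs d 𝒲} {t : ℕ} (h : ∀ i ∈ Finset.Icc 1 t, z i = z' i) :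
    fluctuation P η θinit θ₀ g z t = fluctuation P η θinit θ₀ g z' t := by
  have h1 : ∀ j ≤ t, sgd η θinit g z j = sgd η θinit g z' j := fun j hj =>
    sgd_congr fun i hi => h i (by simp at hi ⊢; lia)
  rw [fluctuation, fluctuation, h1 t le_rfl,
    Finset.sum_congr rfl fun j hj => by rw [h1 j (Finset.mem_range.1 hj).le]]

theorem measurable_fluctuation (P : Measure (Obs d 𝒲)) [IsProbabilityMeasure P] (η : ℝ)
    (θinit θ₀ : EuclideanSpace ℝ (Fin d)) {g : 𝒲 → ℝ} (hg : Measurable g) (t : ℕ) :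
    Measurable fun z : ℕ → Obs d 𝒲 => fluctuation P η θinit θ₀ g z t := by
  have h : ∀ t, Measurable fun z : ℕ → Obs d 𝒲 => sgd η θinit g z t :=
    measurable_sgd (G := fun _ => g) (hg.comp measurable_snd) measurable_pi_apply η θinit
  have h1 : Measurable fun z : ℕ → Obs d 𝒲 => ∑ j ∈ Finset.range t, (sgd η θinit g z j - θ₀) :=
    Finset.measurable_fun_sum _ fun j _ => (h j).sub_const _
  exact (((h t).sub_const _).add (((measurable_momentOp measurable_fst).comp h1).const_smul η)).sub_const _

variable {P : Measure (Obs d 𝒲)} [IsProbabilityMeasure P] {R : ℝ}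

/-- The increment is the update minus its mean given the past, so the process is a martingale once
the observations are independent. -/
theorem fluctuation_succ (hR : ∀ᵐ z ∂P, ‖z.1‖ ≤ R) (η : ℝ) (θinit : EuclideanSpace ℝ (Fin d))
    {θ₀ : EuclideanSpace ℝ (Fin d)} {g : 𝒲 → ℝ} (he : MemLp (residual θ₀ g) 2 P)
    (z : ℕ → Obs d 𝒲) (t : ℕ) :
    fluctuation P η θinit θ₀ g z (t + 1) = fluctuation P η θinit θ₀ g z t
      + ((η * (residual θ₀ g (z (t + 1)) - ⟪sgd η θinit g z t - θ₀, (z (t + 1)).1⟫)) • (z (t + 1)).1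
        - ∫ z', (η * (residual θ₀ g z' - ⟪sgd η θinit g z t - θ₀, z'.1⟫)) • z'.1 ∂P) := by
  rw [integral_increment measurable_fst hR η he, fluctuation, fluctuation, sgd_succ_sub,
    Finset.sum_range_succ, momentOp_add measurable_fst hR]
  push_cast
  module

end Iterates

/-! ### Moment bounds along the trajectory -/

section Bounds

variable {d : ℕ} {𝒲 : Type*} [MeasurableSpace 𝒲] {P : Measure (Obs d 𝒲)} [IsProbabilityMeasure P]
  {R : ℝ} {Ω : Type*} [MeasurableSpace Ω] {μ : Measure Ω} [IsProbabilityMeasure μ]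
  {Z : ℕ → Ω → Obs d 𝒲} {n : ℕ}

/-- The tower property in integrated form: the fresh observation may be averaged first, with the
past held fixed. -/
theorem IsSample.lintegral_step (hs : IsSample μ P Z n) (hZ : ∀ i, Measurable (Z i)) {t : ℕ}
    (ht : t + 1 ≤ n) {β : Type*} [MeasurableSpace β] {F : (ℕ → Obs d 𝒲) → β} (hF : Measurable F)
    (hdep : ∀ z z', (∀ i ∈ Finset.Icc 1 t, z i = z' i) → F z = F z')
    {f : β × Obs d 𝒲 → ℝ≥0∞} (hf : Measurable f) :
    ∫⁻ ω, f (F (fun i => Z i ω), Z (t + 1) ω) ∂μ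
      = ∫⁻ ω, ∫⁻ z, f (F (fun i => Z i ω), z) ∂P ∂μ := by
  rw [lintegral_eq_of_indepFun (T := fun ω => F (fun i => Z i ω))
    (hF.comp (measurable_pi_lambda _ hZ)) (hZ (t + 1))
    (hs.indepFun_prefix ht hF hdep) hf, hs.law (t + 1) (by simp; lia)]

/-- The Lyapunov function stays bounded in mean along the iterates. -/
theorem lintegral_quadForm_sgd_le (hs : IsSample μ P Z n) (hZ : ∀ i, Measurable (Z i)) {η : ℝ}
    {Q : Matrix (Fin d) (Fin d) ℝ} (θinit θ₀ : EuclideanSpace ℝ (Fin d)) {g : 𝒲 → ℝ}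
    (hg : Measurable g) {r K : ℝ≥0} (hr : r < 1) {B : ℝ≥0}
    (hdrift : ∀ δ, ∫⁻ z, ENNReal.ofReal
        (quadForm Q (δ + (η * (residual θ₀ g z - ⟪δ, z.1⟫)) • z.1)) ∂P
      ≤ r * ENNReal.ofReal (quadForm Q δ) + K * B) {t : ℕ} (ht : t ≤ n) :
    ∫⁻ ω, ENNReal.ofReal (quadForm Q (sgd η θinit g (fun i => Z i ω) t - θ₀)) ∂μ
      ≤ ENNReal.ofReal (quadForm Q (θinit - θ₀)) + (K / (1 - r) : ℝ≥0) * B := by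
  induction t with
  | zero => simp [sgd]
  | succ t ih =>
    have hm := measurable_sgd (G := fun _ : ℕ → Obs d 𝒲 => g) (hg.comp measurable_snd)
      measurable_pi_apply η θinit t
    have hres := measurable_residual (d := d) θ₀ hg
    have hf : Measurable fun p : EuclideanSpace ℝ (Fin d) × Obs d 𝒲 => ENNReal.ofReal
        (quadForm Q (p.1 - θ₀ + (η * (residual θ₀ g p.2 - ⟪p.1 - θ₀, p.2.1⟫)) • p.2.1)) := by
      refine ENNReal.measurable_ofReal.comp ((continuous_quadForm Q).measurable.comp ?_)
      have h1 : Measurable fun p : EuclideanSpace ℝ (Fin d) × Obs d 𝒲 => residual θ₀ g p.2 :=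
        hres.comp measurable_snd
      have h2 : Measurable fun p : EuclideanSpace ℝ (Fin d) × Obs d 𝒲 => p.2.1 :=
        measurable_snd.fst
      fun_prop
    simp_rw [sgd_succ_sub]
    rw [hs.lintegral_step hZ ht hm (fun z z' h => sgd_congr h) hf]
    -- K/(1 - r) is the fixed point of x ↦ rx + K, so the bound reproduces itself at each step.
    have hr' : r * (K / (1 - r)) + K = K / (1 - r) := by
      have h0 : (1 - r) ≠ 0 := (tsub_pos_of_lt hr).ne'
      have h1 : r + (1 - r) = 1 := add_tsub_cancel_of_le hr.le
      calc r * (K / (1 - r)) + K = (r + (1 - r)) * (K / (1 - r)) := by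
            rw [add_mul, mul_div_cancel₀ _ h0]
        _ = _ := by rw [h1, one_mul]
    calc _ ≤ ∫⁻ ω, (r * ENNReal.ofReal (quadForm Q (sgd η θinit g (fun i => Z i ω) t - θ₀))
              + K * B) ∂μ := lintegral_mono fun ω => hdrift _
      _ = r * ∫⁻ ω, ENNReal.ofReal (quadForm Q (sgd η θinit g (fun i => Z i ω) t - θ₀)) ∂μ
              + K * B := by
          rw [lintegral_add_right _ measurable_const, lintegral_const_mul' _ _ ENNReal.coe_ne_top]
          simp
      _ ≤ r * (ENNReal.ofReal (quadForm Q (θinit - θ₀)) + (K / (1 - r) : ℝ≥0) * B) + K * B := by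
          gcongr
          exact ih (by lia)
      _ = r * ENNReal.ofReal (quadForm Q (θinit - θ₀))
            + ((r * (K / (1 - r)) + K : ℝ≥0) : ℝ≥0∞) * B := by
          push_cast; ring
      _ ≤ 1 * ENNReal.ofReal (quadForm Q (θinit - θ₀)) + (K / (1 - r) : ℝ≥0) * B := by
          rw [hr']
          gcongr
          exact_mod_cast hr.le
      _ = _ := by rw [one_mul]

/-- The centred partial sums grow at most linearly in mean square. -/
theorem lintegral_fluctuation_le (hs : IsSample μ P Z n) (hZ : ∀ i, Measurable (Z i))
    (hR : ∀ᵐ z ∂P, ‖z.1‖ ≤ R) (η : ℝ) (θinit : EuclideanSpace ℝ (Fin d))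
    {θ₀ : EuclideanSpace ℝ (Fin d)} {g : 𝒲 → ℝ} (hg : Measurable g)
    (he : MemLp (residual θ₀ g) 2 P) {A : ℝ≥0∞}
    (hA : ∀ t ≤ n, ∫⁻ ω, ‖sgd η θinit g (fun i => Z i ω) t - θ₀‖ₑ ^ 2 ∂μ ≤ A) {t : ℕ} (ht : t ≤ n) :
    ∫⁻ ω, ‖fluctuation P η θinit θ₀ g (fun i => Z i ω) t‖ₑ ^ 2 ∂μ
      ≤ ‖θinit - θ₀‖ₑ ^ 2 + t * (ENNReal.ofReal (2 * η ^ 2 * R ^ 4) * A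
        + ENNReal.ofReal (2 * η ^ 2 * R ^ 2 * ∫ z, residual θ₀ g z ^ 2 ∂P)) := by
  induction t with
  | zero => simp [fluctuation, sgd, momentOp]
  | succ t ih =>
    have hm := measurable_sgd (G := fun _ : ℕ → Obs d 𝒲 => g) (hg.comp measurable_snd)
      measurable_pi_apply η θinit t
    have hm2 := measurable_fluctuation P η θinit θ₀ hg t
    have hres := measurable_residual (d := d) θ₀ hg
    have hf : Measurable fun p : (EuclideanSpace ℝ (Fin d) × EuclideanSpace ℝ (Fin d)) × Obs d 𝒲 =>
        ‖p.1.1 + ((η * (residual θ₀ g p.2 - ⟪p.1.2 - θ₀, p.2.1⟫)) • p.2.1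
          - ∫ z', (η * (residual θ₀ g z' - ⟪p.1.2 - θ₀, z'.1⟫)) • z'.1 ∂P)‖ₑ ^ 2 := by
      -- The explicit affine form of the mean makes its measurability in the iterate visible.
      simp_rw [integral_increment measurable_fst hR η he]
      have h1 : Measurable fun p : (EuclideanSpace ℝ (Fin d) × EuclideanSpace ℝ (Fin d)) × Obs d 𝒲 =>
        residual θ₀ g p.2 := hres.comp measurable_snd
      have h2 : Measurable fun p : (EuclideanSpace ℝ (Fin d) × EuclideanSpace ℝ (Fin d)) × Obs d 𝒲 =>
        p.2.1 := measurable_snd.fst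
      have h3 : Measurable fun p : (EuclideanSpace ℝ (Fin d) × EuclideanSpace ℝ (Fin d)) × Obs d 𝒲 =>
        momentOp P Prod.fst (p.1.2 - θ₀) :=
          (measurable_momentOp measurable_fst).comp (measurable_fst.snd.sub_const _)
      fun_prop
    simp_rw [fluctuation_succ hR η θinit he]
    rw [hs.lintegral_step hZ ht (hm2.prodMk hm)
      (fun z z' h => by rw [sgd_congr h, fluctuation_congr h]) hf]
    have hmZ : Measurable fun ω => sgd η θinit g (fun i => Z i ω) t :=
      hm.comp (measurable_pi_lambda _ hZ)
    set c := ENNReal.ofReal (2 * η ^ 2 * R ^ 2 * ∫ z, residual θ₀ g z ^ 2 ∂P)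
    calc _ ≤ ∫⁻ ω, (‖fluctuation P η θinit θ₀ g (fun i => Z i ω) t‖ₑ ^ 2
              + ENNReal.ofReal (2 * η ^ 2 * R ^ 4) * ‖sgd η θinit g (fun i => Z i ω) t - θ₀‖ₑ ^ 2
              + c) ∂μ := lintegral_mono fun ω => lintegral_centered_step_le measurable_fst hR η he _ _
      _ = ∫⁻ ω, ‖fluctuation P η θinit θ₀ g (fun i => Z i ω) t‖ₑ ^ 2 ∂μ
            + ENNReal.ofReal (2 * η ^ 2 * R ^ 4)
              * ∫⁻ ω, ‖sgd η θinit g (fun i => Z i ω) t - θ₀‖ₑ ^ 2 ∂μ + c := by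
          rw [lintegral_add_right _ measurable_const, lintegral_add_right _ (by fun_prop),
            lintegral_const_mul' _ _ ENNReal.ofReal_ne_top]
          simp
      _ ≤ (‖θinit - θ₀‖ₑ ^ 2 + t * (ENNReal.ofReal (2 * η ^ 2 * R ^ 4) * A + c))
            + ENNReal.ofReal (2 * η ^ 2 * R ^ 4) * A + c := by
          gcongr
          · exact ih (by lia)
          · exact hA t (by lia)
      _ = _ := by push_cast; ring

/-- The averaged error in terms of the final iterate, the fluctuation and the bias. -/
theorem norm_avgSGD_sub_le (hR : ∀ᵐ z ∂P, ‖z.1‖ ≤ R) {η lam : ℝ} (hη : 0 < η) (hlam : 0 < lam)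
    (hH : (matrixMean P (fun z => Matrix.vecMulVec z.1.ofLp z.1.ofLp) - lam • 1).PosSemidef)
    (θinit θ₀ : EuclideanSpace ℝ (Fin d)) (g : 𝒲 → ℝ) (z : ℕ → Obs d 𝒲) (hn : 1 ≤ n) :
    ‖avgSGD η θinit g z n - θ₀‖ ^ 2 ≤ 3 / (η * lam) ^ 2 * ((1 / n) ^ 2
        * ‖fluctuation P η θinit θ₀ g z n‖ ^ 2 + (1 / n) ^ 2 * ‖sgd η θinit g z n - θ₀‖ ^ 2
        + η ^ 2 * ‖∫ z, residual θ₀ g z • z.1 ∂P‖ ^ 2) := by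
  have hn0 : (0 : ℝ) < n := by exact_mod_cast hn
  set D := ∑ j ∈ Finset.range n, (sgd η θinit g z j - θ₀) with hD
  set γ := ∫ z, residual θ₀ g z • z.1 ∂P with hγ
  set U := fluctuation P η θinit θ₀ g z n with hU
  set δ := sgd η θinit g z n - θ₀ with hδ
  have e1 : avgSGD η θinit g z n - θ₀ = (1 / n : ℝ) • D := by
    rw [avgSGD, hD, Finset.sum_sub_distrib, smul_sub]
    simp [← Nat.cast_smul_eq_nsmul ℝ, smul_smul, hn0.ne']
  -- The definition of `fluctuation` solved for the sum of errors; coercivity of H then bounds that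
  -- sum.
  have e2 : η • momentOp P Prod.fst D = U - δ + (n * η) • γ := by
    rw [hU, fluctuation, ← hδ, ← hD, ← hγ]; module
  have h1 : η * lam * ‖D‖ ≤ ‖U‖ + ‖δ‖ + n * η * ‖γ‖ := by
    calc η * lam * ‖D‖ = η * (lam * ‖D‖) := by ring
      _ ≤ η * ‖momentOp P Prod.fst D‖ := by
          gcongr; exact le_norm_momentOp measurable_fst hR hH D
      _ = ‖U - δ + (n * η) • γ‖ := by
          rw [← e2, norm_smul, Real.norm_eq_abs, abs_of_pos hη]
      _ ≤ ‖U‖ + ‖δ‖ + ‖(n * η) • γ‖ := (norm_add_le _ _).trans (by gcongr; exact norm_sub_le _ _)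
      _ = _ := by rw [norm_smul, Real.norm_eq_abs, abs_of_pos (by positivity)]
  have h2 : η * lam * ((1 / n) * ‖D‖) ≤ (1 / n) * ‖U‖ + (1 / n) * ‖δ‖ + η * ‖γ‖ := by
    calc η * lam * ((1 / n) * ‖D‖) = (1 / n) * (η * lam * ‖D‖) := by ring
      _ ≤ (1 / n) * (‖U‖ + ‖δ‖ + n * η * ‖γ‖) := by gcongr
      _ = _ := by field_simp
  rw [e1, norm_smul, Real.norm_eq_abs, abs_of_pos (by positivity)]
  set x := (1 / n : ℝ) * ‖D‖
  have h3 : (η * lam * x) ^ 2 ≤ 3 * ((1 / n) ^ 2 * ‖U‖ ^ 2 + (1 / n) ^ 2 * ‖δ‖ ^ 2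
      + η ^ 2 * ‖γ‖ ^ 2) := by
    have hx : 0 ≤ η * lam * x := by positivity
    set p := (1 / n : ℝ) * ‖U‖ with hp
    set q := (1 / n : ℝ) * ‖δ‖ with hq
    set s := η * ‖γ‖ with hs
    calc (η * lam * x) ^ 2 ≤ (p + q + s) ^ 2 := by gcongr
      _ ≤ 3 * (p ^ 2 + q ^ 2 + s ^ 2) := by
          nlinarith [sq_nonneg (p - q), sq_nonneg (p - s), sq_nonneg (q - s)]
      _ = _ := by rw [hp, hq, hs]; ring
  rw [div_mul_eq_mul_div, le_div_iff₀ (by positivity)]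
  calc x ^ 2 * (η * lam) ^ 2 = (η * lam * x) ^ 2 := by ring
    _ ≤ _ := h3

end Bounds

/-! ### Mean square error for a fixed nuisance -/

section MeanSquareError

variable {d : ℕ} {𝒲 : Type*} [MeasurableSpace 𝒲] {P : Measure (Obs d 𝒲)} [IsProbabilityMeasure P]
  {R : ℝ}

theorem enorm_sq_eq_ofReal {E : Type*} [NormedAddCommGroup E] (v : E) :
    ‖v‖ₑ ^ 2 = ENNReal.ofReal (‖v‖ ^ 2) := by
  rw [ENNReal.ofReal_pow (norm_nonneg _), ofReal_norm]

/-- Here s stands for 1/n and b for the squared nuisance error. Mixed terms sb are absorbed by s ≤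
1, and the factor n from the martingale cancels one s. The extra 1 keeps the constant positive. -/
theorem rate_arith {s n : ℝ≥0} (hs1 : s ≤ 1) (hsn : s * n = 1) (k u w₀ w₁ a₀ a₁ c b : ℝ≥0) :
    k * (s ^ 2 * (u + n * (w₀ + w₁ * b)) + s ^ 2 * (a₀ + a₁ * b) + c * b)
      ≤ (k * (u + w₀ + w₁ + a₀ + a₁ + c) + 1) * (s + b) := by
  have h1 : ∀ x y : ℝ≥0, s * (x + y * b) ≤ (x + y) * (s + b) := fun x y => by
    calc s * (x + y * b) = x * s + s * (y * b) := by ring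
      _ ≤ x * s + 1 * (y * b) := by gcongr
      _ ≤ x * s + 1 * (y * b) + (y * s + x * b) := le_self_add
      _ = _ := by ring
  have h2 : s ^ 2 ≤ s := by rw [pow_two]; exact mul_le_of_le_one_left' hs1
  have h3 : s ^ 2 * n = s := by rw [pow_two, mul_assoc, hsn, mul_one]
  calc k * (s ^ 2 * (u + n * (w₀ + w₁ * b)) + s ^ 2 * (a₀ + a₁ * b) + c * b)
      = k * (s ^ 2 * (u + 0 * b) + (s ^ 2 * n) * (w₀ + w₁ * b) + s ^ 2 * (a₀ + a₁ * b)
          + c * b) := by ring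
    _ ≤ k * (s * (u + 0 * b) + s * (w₀ + w₁ * b) + s * (a₀ + a₁ * b) + c * b) := by
        rw [h3]; gcongr
    _ ≤ k * ((u + 0) * (s + b) + (w₀ + w₁) * (s + b) + (a₀ + a₁) * (s + b) + c * (s + b)) :=
        mul_le_mul' le_rfl (add_le_add (add_le_add (add_le_add (h1 _ _) (h1 _ _)) (h1 _ _))
          (mul_le_mul' le_rfl le_add_self))
    _ ≤ k * ((u + 0) * (s + b) + (w₀ + w₁) * (s + b) + (a₀ + a₁) * (s + b) + c * (s + b))
          + (s + b) := le_self_add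
    _ = _ := by ring

/-- The mean square error for fixed nuisance functions, given the moment conditions. -/
theorem exists_mse_bound (hR : ∀ᵐ z ∂P, ‖z.1‖ ≤ R) {η lam : ℝ} (hη : 0 < η) (hlam : 0 < lam)
    (hH : (matrixMean P (fun z => Matrix.vecMulVec z.1.ofLp z.1.ofLp) - lam • 1).PosSemidef)
    (hgap : ∀ A : Matrix (Fin d) (Fin d) ℝ, A.IsSymm → η * ∫ z, quadForm A z.1 ^ 2 ∂P
      ≤ (A.transpose * matrixMean P (fun z => Matrix.vecMulVec z.1.ofLp z.1.ofLp) * A).trace)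
    (θinit θ₀ : EuclideanSpace ℝ (Fin d)) {g₀ : 𝒲 → ℝ}
    (hε2 : MemLp (residual θ₀ g₀) 2 P) (horth : ∫ z, residual θ₀ g₀ z • z.1 ∂P = 0) :
    ∃ C : ℝ≥0, 0 < C ∧ ∀ g : 𝒲 → ℝ, Measurable g → ∀ b : ℝ≥0,
      MemLp (fun z : Obs d 𝒲 => g z.2.1 - g₀ z.2.1) 2 P →
      ∫ z : Obs d 𝒲, (g z.2.1 - g₀ z.2.1) ^ 2 ∂P = b →
      ∀ n : ℕ, 1 ≤ n → ∀ (Ω : Type*) [MeasurableSpace Ω] (μ : Measure Ω) [IsProbabilityMeasure μ]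
        (Z : ℕ → Ω → Obs d 𝒲), IsSample μ P Z n → (∀ i, Measurable (Z i)) →
        ∫⁻ ω, ‖avgSGD η θinit g (fun i => Z i ω) n - θ₀‖ₑ ^ 2 ∂μ ≤ C * (1 / (n : ℝ≥0∞) + b) := by
  obtain ⟨Q, hQ, hQη, hQdec⟩ := exists_lyapunov measurable_fst hR hη hlam hH hgap
  obtain ⟨r, K, hr, hdrift⟩ := exists_drift measurable_fst hR hη hQ hQdec
  set s2 : ℝ≥0 := (∫ z, residual θ₀ g₀ z ^ 2 ∂P).toNNReal with hs2
  set v0 : ℝ≥0 := (quadForm Q (θinit - θ₀)).toNNReal with hv0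
  set L : ℝ≥0 := K / (1 - r)
  set c1 : ℝ≥0 := (1 / η).toNNReal with hc1
  set u0 : ℝ≥0 := ‖θinit - θ₀‖₊ ^ 2 with hu0
  set c2 : ℝ≥0 := (2 * η ^ 2 * R ^ 4).toNNReal with hc2
  set c3 : ℝ≥0 := (2 * η ^ 2 * R ^ 2).toNNReal with hc3
  set c4 : ℝ≥0 := (η ^ 2 * R ^ 2).toNNReal with hc4
  set k : ℝ≥0 := (3 / (η * lam) ^ 2).toNNReal with hk
  -- a0 + a1·b bounds E|δ_t|² uniformly in t; `c1` = 1/η comes from η|v|² ≤ Q(v).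
  set a0 : ℝ≥0 := c1 * (v0 + 2 * L * s2) with ha0
  set a1 : ℝ≥0 := 2 * c1 * L with ha1
  refine ⟨k * (u0 + (c2 * a0 + 2 * c3 * s2) + (c2 * a1 + 2 * c3) + a0 + a1 + c4) + 1,
    by positivity, ?_⟩
  intro g hg b hmem hb n hn Ω _ μ _ Z hs hZ
  have hXi : MemLp (fun z : Obs d 𝒲 => z.1) ∞ P :=
    memLp_top_of_bound measurable_fst.aestronglyMeasurable R hR
  have hres : ∀ z : Obs d 𝒲, residual θ₀ g z = residual θ₀ g₀ z - (g z.2.1 - g₀ z.2.1) :=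
    fun z => by simp only [residual]; ring
  have he : MemLp (residual θ₀ g) 2 P := (hε2.sub hmem).ae_eq (.of_forall fun z => (hres z).symm)
  -- From e = ε - (g - g₀) and (x - y)² ≤ 2x² + 2y².
  set B : ℝ≥0 := 2 * s2 + 2 * b with hB
  have heB : ∫ z, residual θ₀ g z ^ 2 ∂P ≤ B := by
    have h1 : (B : ℝ) = ∫ z : Obs d 𝒲, (2 * residual θ₀ g₀ z ^ 2 + 2 * (g z.2.1 - g₀ z.2.1) ^ 2) ∂P := by
      rw [integral_add (hε2.integrable_sq.const_mul _) (hmem.integrable_sq.const_mul _),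
        integral_const_mul, integral_const_mul, hb, hB]
      push_cast
      rw [hs2, Real.coe_toNNReal _ (integral_nonneg fun _ => sq_nonneg _)]
    rw [h1]
    refine integral_mono he.integrable_sq
      ((hε2.integrable_sq.const_mul _).add (hmem.integrable_sq.const_mul _)) fun z => ?_
    simp only [hres]
    nlinarith [sq_nonneg (residual θ₀ g₀ z + (g z.2.1 - g₀ z.2.1))]
  have heB' : ENNReal.ofReal (∫ z, residual θ₀ g z ^ 2 ∂P) ≤ B := by
    rw [← ENNReal.ofReal_coe_nnreal]; exact ENNReal.ofReal_le_ofReal heB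
  set A : ℝ≥0 := a0 + a1 * b with hA
  have hAt : ∀ t ≤ n, ∫⁻ ω, ‖sgd η θinit g (fun i => Z i ω) t - θ₀‖ₑ ^ 2 ∂μ ≤ A := fun t ht => by
    have h1 := lintegral_quadForm_sgd_le (η := η) (Q := Q) hs hZ θinit θ₀ hg hr (B := B)
      (fun δ => (hdrift _ he δ).trans (by gcongr)) ht
    calc ∫⁻ ω, ‖sgd η θinit g (fun i => Z i ω) t - θ₀‖ₑ ^ 2 ∂μ
        ≤ ∫⁻ ω, c1 * ENNReal.ofReal (quadForm Q (sgd η θinit g (fun i => Z i ω) t - θ₀)) ∂μ := by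
          refine lintegral_mono fun ω => ?_
          rw [enorm_sq_eq_ofReal, hc1]
          change _ ≤ ENNReal.ofReal (1 / η) * _
          rw [← ENNReal.ofReal_mul (by positivity)]
          refine ENNReal.ofReal_le_ofReal ?_
          rw [one_div, inv_mul_eq_div, le_div_iff₀ hη, mul_comm]
          exact hQη _
      _ = c1 * ∫⁻ ω, ENNReal.ofReal (quadForm Q (sgd η θinit g (fun i => Z i ω) t - θ₀)) ∂μ :=
          lintegral_const_mul' _ _ ENNReal.coe_ne_top
      _ ≤ c1 * (v0 + L * B) := by gcongr; exact h1
      _ = A := by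
          rw [hA, ha0, ha1, hB]; push_cast; ring
  have hF : ∫⁻ ω, ‖fluctuation P η θinit θ₀ g (fun i => Z i ω) n‖ₑ ^ 2 ∂μ
      ≤ u0 + n * (c2 * A + c3 * B) := by
    refine (lintegral_fluctuation_le hs hZ hR η θinit hg he hAt le_rfl).trans ?_
    rw [ENNReal.ofReal_mul (p := 2 * η ^ 2 * R ^ 2) (by positivity)]
    have e1 : ‖θinit - θ₀‖ₑ ^ 2 = (u0 : ℝ≥0∞) := by rw [hu0, ENNReal.coe_pow]; rfl
    rw [e1]
    gcongr
    · exact le_rfl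
    · exact le_rfl
  -- Only the nuisance error contributes to the mean of eX, since ε is orthogonal to X.
  have hγ : ‖∫ z, residual θ₀ g z • z.1 ∂P‖ ^ 2 ≤ R ^ 2 * b := by
    have e1 : ∀ z : Obs d 𝒲, residual θ₀ g z • z.1
        = residual θ₀ g₀ z • z.1 - (g z.2.1 - g₀ z.2.1) • z.1 := fun z => by rw [hres, sub_smul]
    simp_rw [e1]
    have i1 : MemLp (fun z : Obs d 𝒲 => residual θ₀ g₀ z • z.1) 2 P := hXi.smul hε2
    have i2 : MemLp (fun z : Obs d 𝒲 => (g z.2.1 - g₀ z.2.1) • z.1) 2 P := hXi.smul hmem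
    rw [integral_sub (i1.integrable one_le_two) (i2.integrable one_le_two), horth, zero_sub,
      norm_neg, ← hb]
    exact norm_integral_smul_sq_le measurable_fst hR hmem
  set s : ℝ≥0 := 1 / n with hsdef
  have hs1 : s ≤ 1 := by
    rw [hsdef, one_div]; exact inv_le_one_of_one_le₀ (by exact_mod_cast hn)
  have hsn : s * n = 1 := by
    rw [hsdef, one_div]; exact inv_mul_cancel₀ (by positivity)
  have hpt : ∀ ω, ‖avgSGD η θinit g (fun i => Z i ω) n - θ₀‖ₑ ^ 2 ≤ k *
      ((s ^ 2 : ℝ≥0) * ‖fluctuation P η θinit θ₀ g (fun i => Z i ω) n‖ₑ ^ 2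
        + (s ^ 2 : ℝ≥0) * ‖sgd η θinit g (fun i => Z i ω) n - θ₀‖ₑ ^ 2 + (c4 * b : ℝ≥0)) := fun ω => by
    have h1 := norm_avgSGD_sub_le hR hη hlam hH θinit θ₀ g (fun i => Z i ω) hn
    have h2 : ((s ^ 2 : ℝ≥0) : ℝ≥0∞) = ENNReal.ofReal ((1 / n : ℝ) ^ 2) := by
      rw [← ENNReal.ofReal_coe_nnreal, hsdef]; push_cast; rfl
    have h3 : ((c4 * b : ℝ≥0) : ℝ≥0∞) = ENNReal.ofReal (η ^ 2 * (R ^ 2 * b)) := by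
      rw [← ENNReal.ofReal_coe_nnreal, hc4]; push_cast
      rw [Real.coe_toNNReal _ (by positivity), mul_assoc]
    simp_rw [enorm_sq_eq_ofReal]
    rw [h2, h3, hk, ← ENNReal.ofReal_mul (by positivity), ← ENNReal.ofReal_mul (by positivity),
      ← ENNReal.ofReal_add (by positivity) (by positivity),
      ← ENNReal.ofReal_add (by positivity) (by positivity)]
    change _ ≤ ENNReal.ofReal _ * _
    rw [← ENNReal.ofReal_mul (by positivity)]
    refine ENNReal.ofReal_le_ofReal (h1.trans ?_)
    gcongr
  have hm : Measurable fun ω => sgd η θinit g (fun i => Z i ω) n :=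
    (measurable_sgd (G := fun _ : ℕ → Obs d 𝒲 => g) (hg.comp measurable_snd)
      measurable_pi_apply η θinit n).comp (measurable_pi_lambda _ hZ)
  have hfinal : k * (s ^ 2 * (u0 + n * (c2 * A + c3 * B)) + s ^ 2 * A + c4 * b)
      ≤ (k * (u0 + (c2 * a0 + 2 * c3 * s2) + (c2 * a1 + 2 * c3) + a0 + a1 + c4) + 1) * (s + b) := by
    have h := rate_arith hs1 hsn k u0 (c2 * a0 + 2 * c3 * s2) (c2 * a1 + 2 * c3) a0 a1 c4 b
    have e1 : c2 * a0 + 2 * c3 * s2 + (c2 * a1 + 2 * c3) * b = c2 * A + c3 * B := by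
      rw [hA, hB]; ring
    rwa [e1, ← hA] at h
  have hs' : (1 / (n : ℝ≥0∞)) = (s : ℝ≥0∞) := by
    rw [hsdef, ENNReal.coe_div (by positivity)]; simp
  calc ∫⁻ ω, ‖avgSGD η θinit g (fun i => Z i ω) n - θ₀‖ₑ ^ 2 ∂μ
      ≤ ∫⁻ ω, k * ((s ^ 2 : ℝ≥0) * ‖fluctuation P η θinit θ₀ g (fun i => Z i ω) n‖ₑ ^ 2
        + (s ^ 2 : ℝ≥0) * ‖sgd η θinit g (fun i => Z i ω) n - θ₀‖ₑ ^ 2 + (c4 * b : ℝ≥0)) ∂μ :=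
        lintegral_mono hpt
    _ = k * ((s ^ 2 : ℝ≥0) * ∫⁻ ω, ‖fluctuation P η θinit θ₀ g (fun i => Z i ω) n‖ₑ ^ 2 ∂μ
        + (s ^ 2 : ℝ≥0) * ∫⁻ ω, ‖sgd η θinit g (fun i => Z i ω) n - θ₀‖ₑ ^ 2 ∂μ
        + (c4 * b : ℝ≥0)) := by
        rw [lintegral_const_mul' _ _ ENNReal.coe_ne_top, lintegral_add_right _ measurable_const,
          lintegral_add_right _ (by fun_prop), lintegral_const_mul' _ _ ENNReal.coe_ne_top,
          lintegral_const_mul' _ _ ENNReal.coe_ne_top]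
        simp
    _ ≤ k * ((s ^ 2 : ℝ≥0) * (u0 + n * (c2 * A + c3 * B)) + (s ^ 2 : ℝ≥0) * A
        + (c4 * b : ℝ≥0)) := by
        gcongr
        exact hAt n le_rfl
    _ ≤ _ := by
        rw [hs']
        exact_mod_cast hfinal

end MeanSquareError

/-! ### Conditioning on an independent variable -/

section Conditional

/-- Conditionally on an independent variable, expectation is integration over the other one. -/
theorem lintegral_ae_eq_condLExp_of_indepFun {Ω S O : Type*} [MeasurableSpace Ω] [mS : MeasurableSpace S]
    [MeasurableSpace O] {μ : Measure Ω} [IsProbabilityMeasure μ] {ι : Ω → S} {T : Ω → O}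
    (hι : Measurable ι) (hT : Measurable T) (h : IndepFun ι T μ) {f : S × O → ℝ≥0∞}
    (hf : Measurable f) :
    (fun ω => ∫⁻ ω', f (ι ω, T ω') ∂μ) =ᵐ[μ] condLExp (mS.comap ι) μ (fun ω => f (ι ω, T ω)) := by
  have hprob : IsProbabilityMeasure (μ.map T) := Measure.isProbabilityMeasure_map hT.aemeasurable
  have hmap : ∀ s, ∫⁻ ω', f (s, T ω') ∂μ = ∫⁻ o, f (s, o) ∂(μ.map T) := fun s =>
    (lintegral_map (hf.comp measurable_prodMk_left) hT).symm
  simp_rw [hmap]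
  refine ae_eq_condLExp (hm := hι.comap_le) μ _
    (hf.lintegral_prod_right'.comp (comap_measurable ι)) fun s hs => ?_
  obtain ⟨s, hs, rfl⟩ := hs
  have hm : MeasurableSet (ι ⁻¹' s) := hι hs
  -- Restricting f to s × univ localizes the product formula to the event ι ∈ s.
  have key := lintegral_eq_of_indepFun hι hT h
    (f := (s ×ˢ Set.univ).indicator f) (hf.indicator (hs.prod .univ))
  rw [← lintegral_indicator hm, ← lintegral_indicator hm]
  have e1 : ∀ ω, (s ×ˢ Set.univ).indicator f (ι ω, T ω)
      = (ι ⁻¹' s).indicator (fun ω => f (ι ω, T ω)) ω := fun ω => by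
    by_cases hω : ι ω ∈ s <;> simp [Set.indicator, hω]
  have e2 : ∀ ω, ∫⁻ o, (s ×ˢ Set.univ).indicator f (ι ω, o) ∂(μ.map T)
      = (ι ⁻¹' s).indicator (fun ω => ∫⁻ o, f (ι ω, o) ∂(μ.map T)) ω := fun ω => by
    by_cases hω : ι ω ∈ s <;> simp [Set.indicator, hω]
  simp_rw [e1, e2] at key
  exact key.symm

end Conditional

/-! ### Consequences of the model assumptions -/

section Model

variable {d : ℕ} {𝒲 : Type*} [MeasurableSpace 𝒲] {P : Measure (Obs d 𝒲)}

theorem nuisanceNorm_sq {h : 𝒲 → ℝ} (hf : MemLp (fun z : Obs d 𝒲 => h z.2.1) 2 P) :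
    nuisanceNorm P h ^ 2 = ENNReal.ofReal (∫ z : Obs d 𝒲, h z.2.1 ^ 2 ∂P) := by
  rw [ofReal_integral_eq_lintegral_ofReal hf.integrable_sq (.of_forall fun _ => sq_nonneg _),
    nuisanceNorm]
  have := eLpNorm_nnreal_pow_eq_lintegral (f := fun z : Obs d 𝒲 => h z.2.1) (μ := P) (p := 2)
    (by norm_num)
  simp only [NNReal.coe_ofNat, ENNReal.rpow_ofNat, ENNReal.coe_ofNat] at this
  rw [this]
  refine lintegral_congr fun z => ?_
  rw [enorm_sq_eq_ofReal, Real.norm_eq_abs, sq_abs]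

theorem norm_le_of_sup_norm_le {x : EuclideanSpace ℝ (Fin d)} {c : ℝ} (hx : ‖x.ofLp‖ ≤ c) :
    ‖x‖ ≤ √(d * c ^ 2) := by
  refine Real.le_sqrt_of_sq_le ?_
  rw [EuclideanSpace.real_norm_sq_eq]
  calc ∑ i, x i ^ 2 ≤ ∑ _i : Fin d, c ^ 2 := by
        refine Finset.sum_le_sum fun i _ => ?_
        have h := (norm_le_pi_norm x.ofLp i).trans hx
        rw [← sq_abs]
        exact pow_le_pow_left₀ (abs_nonneg _) h 2
    _ = d * c ^ 2 := by simp

theorem secondMoment_eq_matrixMean :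
    secondMoment P = matrixMean P (fun z => Matrix.vecMulVec z.1.ofLp z.1.ofLp) := by
  ext i j
  simp [secondMoment, matrixMean, Matrix.vecMulVec_apply]

theorem secondMoment_sub_posSemidef {lam : ℝ} (hH : ∀ ev ∈ spectrum ℝ (secondMoment P), lam ≤ ev) :
    (secondMoment P - lam • 1).PosSemidef := by
  rw [Matrix.posSemidef_iff_isHermitian_and_spectrum_nonneg]
  constructor
  · refine Matrix.IsHermitian.sub ?_ (by ext i j; simp [Matrix.one_apply, eq_comm])
    ext i j
    simp [secondMoment, mul_comm]
  · rw [← Algebra.algebraMap_eq_smul_one, ← spectrum.sub_singleton_eq]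
    rintro _ ⟨ev, hev, _, rfl, rfl⟩
    exact sub_nonneg.2 (hH ev hev)

/-- Some η' > η satisfies the strict condition, and the fourth-moment term is nonnegative, so the
inequality passes down to η. Strictness is not needed: coercivity of H supplies the decrease. -/
theorem step_size_gap {η : ℝ} (hη : (η : EReal) < etaMax P) {A : Matrix (Fin d) (Fin d) ℝ}
    (hA : A.IsSymm) :
    η * ∫ z, quadForm A z.1 ^ 2 ∂P ≤ (A.transpose * secondMoment P * A).trace := by
  rcases eq_or_ne A 0 with rfl | h0
  · simp [quadForm]
  obtain ⟨_, ⟨η', ⟨-, h⟩, rfl⟩, hlt⟩ := lt_sSup_iff.1 hη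
  have h1 := h A hA h0
  have h2 : η * ∫ z, quadForm A z.1 ^ 2 ∂P ≤ η' * ∫ z, quadForm A z.1 ^ 2 ∂P :=
    mul_le_mul_of_nonneg_right (EReal.coe_lt_coe_iff.1 hlt).le (integral_nonneg fun _ => sq_nonneg _)
  linarith

variable [IsProbabilityMeasure P] {R : ℝ}

/-- The noise is uncorrelated with the regressors. -/
theorem integral_residual_mul_inner_eq_zero (hR : ∀ᵐ z ∂P, ‖z.1‖ ≤ R)
    {θ₀ : EuclideanSpace ℝ (Fin d)} {g₀ : 𝒲 → ℝ} (hε2 : MemLp (residual θ₀ g₀) 2 P)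
    (hε : P[residual θ₀ g₀ | MeasurableSpace.comap
      (fun z : Obs d 𝒲 => (z.1, z.2.1)) inferInstance] =ᵐ[P] 0) (v : EuclideanSpace ℝ (Fin d)) :
    ∫ z, residual θ₀ g₀ z * ⟪v, z.1⟫ ∂P = 0 := by
  have hle : MeasurableSpace.comap (fun z : Obs d 𝒲 => (z.1, z.2.1)) inferInstance
      ≤ (inferInstance : MeasurableSpace (Obs d 𝒲)) :=
    (measurable_fst.prodMk measurable_snd.fst).comap_le
  have hv : MemLp (fun z : Obs d 𝒲 => ⟪v, z.1⟫) 2 P :=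
    (memLp_two_iff_integrable_sq
      ((measurable_const.inner measurable_fst).aestronglyMeasurable)).2
      (integrable_continuous_comp_of_bounded (f := fun x => ⟪v, x⟫ ^ 2) measurable_fst hR
        (by fun_prop))
  have hvm : StronglyMeasurable[MeasurableSpace.comap (fun z : Obs d 𝒲 => (z.1, z.2.1))
      inferInstance] (fun z : Obs d 𝒲 => ⟪v, z.1⟫) := by
    have h1 : Measurable fun p : EuclideanSpace ℝ (Fin d) × 𝒲 => ⟪v, p.1⟫ := by fun_prop
    exact (h1.comp (comap_measurable _)).stronglyMeasurable
  have h := condExp_mul_of_stronglyMeasurable_right hvm (hε2.integrable_mul hv)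
    (hε2.integrable one_le_two)
  rw [← integral_condExp hle]
  have h2 : P[residual θ₀ g₀ * (fun z : Obs d 𝒲 => ⟪v, z.1⟫) | MeasurableSpace.comap
      (fun z : Obs d 𝒲 => (z.1, z.2.1)) inferInstance] =ᵐ[P] 0 := by
    filter_upwards [h, hε] with z h1 h2
    rw [h1, Pi.mul_apply, h2]; simp
  exact (integral_congr_ae h2).trans (by simp)

theorem integral_residual_smul_eq_zero (hR : ∀ᵐ z ∂P, ‖z.1‖ ≤ R)
    {θ₀ : EuclideanSpace ℝ (Fin d)} {g₀ : 𝒲 → ℝ} (hε2 : MemLp (residual θ₀ g₀) 2 P)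
    (hε : P[residual θ₀ g₀ | MeasurableSpace.comap
      (fun z : Obs d 𝒲 => (z.1, z.2.1)) inferInstance] =ᵐ[P] 0) :
    ∫ z, residual θ₀ g₀ z • z.1 ∂P = 0 := by
  have hXi : MemLp (fun z : Obs d 𝒲 => z.1) ∞ P :=
    memLp_top_of_bound measurable_fst.aestronglyMeasurable R hR
  have i1 : MemLp (fun z : Obs d 𝒲 => residual θ₀ g₀ z • z.1) 2 P := hXi.smul hε2
  refine ext_inner_left ℝ fun v => ?_
  rw [← integral_inner (i1.integrable one_le_two), inner_zero_right,
    ← integral_residual_mul_inner_eq_zero hR hε2 hε v]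
  simp [inner_smul_right]

/-- The population risk at the true nuisance is minimized only at the true parameter. -/
theorem eq_of_isMinOn_risk (hR : ∀ᵐ z ∂P, ‖z.1‖ ≤ R) {lam : ℝ} (hlam : 0 < lam)
    (hH : (matrixMean P (fun z => Matrix.vecMulVec z.1.ofLp z.1.ofLp) - lam • 1).PosSemidef)
    {θ₀ : EuclideanSpace ℝ (Fin d)} {g₀ : 𝒲 → ℝ} (hε2 : MemLp (residual θ₀ g₀) 2 P)
    (hε : P[residual θ₀ g₀ | MeasurableSpace.comap
      (fun z : Obs d 𝒲 => (z.1, z.2.1)) inferInstance] =ᵐ[P] 0)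
    {θ : EuclideanSpace ℝ (Fin d)} (hθ : IsMinOn (fun θ => risk P θ g₀) Set.univ θ) : θ = θ₀ := by
  have hmin : risk P θ g₀ ≤ risk P θ₀ g₀ := hθ (Set.mem_univ θ₀)
  set v := θ - θ₀ with hv
  have i2 : Integrable (fun z : Obs d 𝒲 => ⟪v, z.1⟫ ^ 2) P :=
    integrable_continuous_comp_of_bounded (f := fun x => ⟪v, x⟫ ^ 2) measurable_fst hR
      (by fun_prop)
  have hvL : MemLp (fun z : Obs d 𝒲 => ⟪v, z.1⟫) 2 P :=
    (memLp_two_iff_integrable_sq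
      ((measurable_const.inner measurable_fst).aestronglyMeasurable)).2 i2
  have i1 : Integrable (fun z : Obs d 𝒲 => residual θ₀ g₀ z * ⟪v, z.1⟫) P :=
    hε2.integrable_mul hvL
  have i0 := hε2.integrable_sq
  have e0 : risk P θ₀ g₀ = 1 / 2 * ∫ z, residual θ₀ g₀ z ^ 2 ∂P := by
    rw [← integral_const_mul]; rfl
  have e1 : risk P θ g₀ = 1 / 2 * (∫ z, residual θ₀ g₀ z ^ 2 ∂P
      - 2 * ∫ z, residual θ₀ g₀ z * ⟪v, z.1⟫ ∂P + ∫ z, ⟪v, z.1⟫ ^ 2 ∂P) := by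
    have i01 : Integrable (fun z => residual θ₀ g₀ z ^ 2 - 2 * (residual θ₀ g₀ z * ⟪v, z.1⟫)) P :=
      i0.sub (i1.const_mul 2)
    rw [← integral_const_mul 2, ← integral_sub i0 (i1.const_mul 2), ← integral_add i01 i2,
      ← integral_const_mul]
    refine integral_congr_ae (.of_forall fun z => ?_)
    simp only [loss, residual, hv, inner_sub_left]
    ring
  -- With the cross term gone, the excess risk is ½E⟨v, X⟩², which is at least ½·lam·|v|².
  rw [e0, e1, integral_residual_mul_inner_eq_zero hR hε2 hε v] at hmin
  have h := le_integral_inner_sq measurable_fst hR hH v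
  have h0 : ‖v‖ ^ 2 ≤ 0 := by nlinarith
  have h1 : ‖v‖ = 0 := by nlinarith [norm_nonneg v]
  exact sub_eq_zero.1 (norm_eq_zero.1 h1)

end Model

/-! ### From fixed to random nuisance functions -/

section RandomNuisance

variable {d : ℕ} {𝒲 : Type*}

/-- A finite sample, extended to a sequence by a default observation. -/
def extendSample {n : ℕ} (z₀ : Obs d 𝒲) (z : Finset.Icc 1 n → Obs d 𝒲) (i : ℕ) : Obs d 𝒲 :=
  if h : i ∈ Finset.Icc 1 n then z ⟨i, h⟩ else z₀

theorem extendSample_apply {n : ℕ} (z₀ : Obs d 𝒲) (z : ℕ → Obs d 𝒲) {i : ℕ}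
    (h : i ∈ Finset.Icc 1 n) : extendSample z₀ (fun j : Finset.Icc 1 n => z j) i = z i := by
  simp only [extendSample, dif_pos h]

variable [MeasurableSpace 𝒲]

theorem measurable_extendSample {n : ℕ} (z₀ : Obs d 𝒲) (i : ℕ) :
    Measurable fun z : Finset.Icc 1 n → Obs d 𝒲 => extendSample z₀ z i := by
  by_cases h : i ∈ Finset.Icc 1 n
  · simp only [extendSample, dif_pos h]; exact measurable_pi_apply _
  · simp only [extendSample, dif_neg h]; exact measurable_const

theorem IsSample.measurable_pi {Ω : Type*} [MeasurableSpace Ω] {μ : Measure Ω}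
    {P : Measure (Obs d 𝒲)} {Z : ℕ → Ω → Obs d 𝒲} {n : ℕ} (hs : IsSample μ P Z n) :
    Measurable fun ω (j : Finset.Icc 1 n) => Z j ω :=
  measurable_pi_lambda _ fun j => hs.measurable j.1 j.2

theorem IsSample.extend {Ω : Type*} [MeasurableSpace Ω] {μ : Measure Ω}
    {P : Measure (Obs d 𝒲)} {Z : ℕ → Ω → Obs d 𝒲} {n : ℕ} (hs : IsSample μ P Z n) (z₀ : Obs d 𝒲) :
    IsSample μ P (fun i ω => extendSample z₀ (fun j : Finset.Icc 1 n => Z j ω) i) n := by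
  have h : ∀ i ∈ Finset.Icc 1 n,
      (fun ω => extendSample z₀ (fun j : Finset.Icc 1 n => Z j ω) i) = Z i := fun i hi => by
    funext ω
    exact extendSample_apply z₀ (fun i => Z i ω) hi
  refine ⟨fun i hi => ?_, fun i hi => ?_, ?_⟩
  · rw [h i hi]; exact hs.measurable i hi
  · rw [h i hi]; exact hs.law i hi
  · have : (fun i : Finset.Icc 1 n => fun ω =>
        extendSample z₀ (fun j : Finset.Icc 1 n => Z j ω) i) = fun i : Finset.Icc 1 n => Z i :=
      funext fun i => h i.1 i.2
    rw [this]; exact hs.indep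

/-- Conditional and total mean square error for random nuisance functions, given the bound for
fixed ones. -/
theorem condLExp_mse_le {P : Measure (Obs d 𝒲)} [IsProbabilityMeasure P] {η : ℝ}
    {θinit θ₀ : EuclideanSpace ℝ (Fin d)} {g₀ : 𝒲 → ℝ} (hg₀ : Measurable g₀) {n : ℕ}
    {Ω : Type*} [MeasurableSpace Ω] {μ : Measure Ω} [IsProbabilityMeasure μ]
    {Z : ℕ → Ω → Obs d 𝒲} (hs : IsSample μ P Z n) {C : ℝ≥0} (hC : 0 < C)
    (hfix : ∀ g : 𝒲 → ℝ, Measurable g → ∀ b : ℝ≥0,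
      MemLp (fun z : Obs d 𝒲 => g z.2.1 - g₀ z.2.1) 2 P →
      ∫ z : Obs d 𝒲, (g z.2.1 - g₀ z.2.1) ^ 2 ∂P = b →
      ∀ Z : ℕ → Ω → Obs d 𝒲, IsSample μ P Z n → (∀ i, Measurable (Z i)) →
        ∫⁻ ω, ‖avgSGD η θinit g (fun i => Z i ω) n - θ₀‖ₑ ^ 2 ∂μ ≤ C * (1 / (n : ℝ≥0∞) + b))
    {S : Type*} [mS : MeasurableSpace S] {ι : Ω → S} (hι : Measurable ι) {ghat : S → 𝒲 → ℝ}
    (hghat : Measurable (Function.uncurry ghat))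
    (hind : IndepFun ι (fun ω (j : Finset.Icc 1 n) => Z j ω) μ) :
    (∀ᵐ ω ∂μ, condLExp (mS.comap ι) μ (fun ω' =>
        ‖avgSGD η θinit (ghat (ι ω')) (fun i => Z i ω') n - θ₀‖ₑ ^ 2) ω
      ≤ C * (1 / (n : ℝ≥0∞) + nuisanceNorm P (fun w => ghat (ι ω) w - g₀ w) ^ 2)) ∧
    ∫⁻ ω, ‖avgSGD η θinit (ghat (ι ω)) (fun i => Z i ω) n - θ₀‖ₑ ^ 2 ∂μ
      ≤ C * (1 / (n : ℝ≥0∞) + ∫⁻ ω, nuisanceNorm P (fun w => ghat (ι ω) w - g₀ w) ^ 2 ∂μ) := by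
  obtain ⟨z₀⟩ := nonempty_of_isProbabilityMeasure P
  have hT := hs.measurable_pi
  set T : Ω → Finset.Icc 1 n → Obs d 𝒲 := fun ω j => Z j ω with hTdef
  let f : S × (Finset.Icc 1 n → Obs d 𝒲) → ℝ≥0∞ := fun p =>
    ‖avgSGD η θinit (ghat p.1) (extendSample z₀ p.2) n - θ₀‖ₑ ^ 2
  have hf : Measurable f := by
    have h1 : Measurable (Function.uncurry fun p : S × (Finset.Icc 1 n → Obs d 𝒲) => ghat p.1) :=
      hghat.comp (measurable_fst.fst.prodMk measurable_snd)
    have h2 := measurable_avgSGD h1 (z := fun p => extendSample z₀ p.2)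
      (fun i => (measurable_extendSample z₀ i).comp measurable_snd) η θinit n
    exact (h2.sub_const θ₀).enorm.pow_const 2
  have hfT : ∀ ω, f (ι ω, T ω) = ‖avgSGD η θinit (ghat (ι ω)) (fun i => Z i ω) n - θ₀‖ₑ ^ 2 :=
    fun ω => by
      simp only [f]
      rw [avgSGD_congr fun i hi => extendSample_apply z₀ (fun i => Z i ω) hi]
  have hbd : ∀ s, ∫⁻ ω, f (s, T ω) ∂μ
      ≤ C * (1 / (n : ℝ≥0∞) + nuisanceNorm P (fun w => ghat s w - g₀ w) ^ 2) := fun s => by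
    have hgs : Measurable (ghat s) := hghat.comp measurable_prodMk_left
    -- If the nuisance error is infinite, so is the right-hand side; this uses C > 0, since 0 · ∞ =
    -- 0.
    by_cases htop : nuisanceNorm P (fun w => ghat s w - g₀ w) = ∞
    · rw [htop]
      simp [ENNReal.mul_top, hC.ne']
    · have hmem : MemLp (fun z : Obs d 𝒲 => ghat s z.2.1 - g₀ z.2.1) 2 P :=
        ⟨((hgs.sub hg₀).comp measurable_snd.fst).aestronglyMeasurable, lt_top_iff_ne_top.2 htop⟩
      rw [nuisanceNorm_sq hmem]
      exact hfix (ghat s) hgs _ hmem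
        (Real.coe_toNNReal _ (integral_nonneg fun _ => sq_nonneg _)).symm _ (hs.extend z₀)
        fun i => (measurable_extendSample z₀ i).comp hT
  simp_rw [← hfT]
  constructor
  · filter_upwards [lintegral_ae_eq_condLExp_of_indepFun hι hT hind hf] with ω hω
    rw [← hω]
    exact hbd (ι ω)
  · rw [lintegral_eq_of_indepFun hι hT hind hf]
    have hmap : ∀ s, ∫⁻ o, f (s, o) ∂(μ.map T) = ∫⁻ ω', f (s, T ω') ∂μ := fun s =>
      lintegral_map (hf.comp measurable_prodMk_left) hT
    simp_rw [hmap]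
    refine (lintegral_mono fun ω => hbd (ι ω)).trans_eq ?_
    rw [lintegral_const_mul' _ _ ENNReal.coe_ne_top, lintegral_add_left measurable_const]
    simp

end RandomNuisance

end PLM

/-! ### Assembly -/

theorem mainTheorem6 {d : ℕ} {𝒲 : Type*} [MeasurableSpace 𝒲]
    (P : Measure (PLM.Obs d 𝒲)) [IsProbabilityMeasure P]
    (θ₀ : EuclideanSpace ℝ (Fin d)) (g₀ : 𝒲 → ℝ) (hg₀ : Measurable g₀)
    -- the partially linear model: `E[ε | X, W] = 0` for `ε = Y - g₀(W) - ⟨θ₀, X⟩`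
    (hε : P[PLM.residual θ₀ g₀ | MeasurableSpace.comap
      (fun z : PLM.Obs d 𝒲 => (z.1, z.2.1)) inferInstance] =ᵐ[P] 0)
    -- `λ_min(E[X Xᵀ]) ≥ lam₀ > 0`
    (lam₀ : ℝ) (hlam₀ : 0 < lam₀)
    (hH : ∀ ev ∈ spectrum ℝ (PLM.secondMoment P), lam₀ ≤ ev)
    -- `‖X‖_∞ ≤ C_X` almost surely
    (CX : ℝ) (hCX : 0 < CX) (hX : ∀ᵐ z ∂P, ‖z.1.ofLp‖ ≤ CX)
    -- `E[ε²] ≤ σ²`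
    (σ : ℝ) (hσ : 0 < σ) (hε2 : MemLp (PLM.residual θ₀ g₀) 2 P)
    (hεσ : ∫ z, PLM.residual θ₀ g₀ z ^ 2 ∂P ≤ σ ^ 2)
    -- the target is a minimizer of the risk at the true nuisance
    (θstar : EuclideanSpace ℝ (Fin d))
    (hθstar : IsMinOn (fun θ => PLM.risk P θ g₀) Set.univ θstar)
    (η : ℝ) (hη : 0 < η) (hηmax : (η : EReal) < PLM.etaMax P)
    (θinit : EuclideanSpace ℝ (Fin d)) :
    ∃ C : ℝ≥0, ∀ n : ℕ, 1 ≤ n →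
      ∀ (Ω : Type*) (m : MeasurableSpace Ω) [MeasurableSpace Ω] (μ : Measure Ω)
        [IsProbabilityMeasure μ] (Z : ℕ → Ω → PLM.Obs d 𝒲) (ghat : Ω → 𝒲 → ℝ),
        PLM.IsSample μ P Z n → PLM.IsIndepEstimator m μ Z n ghat →
        -- conditionally on the data used for `ĝ`
        (∀ᵐ ω ∂μ,
          condLExp m μ (fun ω' =>
              ‖PLM.avgSGD η θinit (ghat ω') (fun i => Z i ω') n - θstar‖ₑ ^ 2) ω
            ≤ C * (1 / (n : ℝ≥0∞) + PLM.nuisanceNorm P (fun w => ghat ω w - g₀ w) ^ 2)) ∧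
        -- and in total expectation
        ∫⁻ ω, ‖PLM.avgSGD η θinit (ghat ω) (fun i => Z i ω) n - θstar‖ₑ ^ 2 ∂μ
          ≤ C * (1 / (n : ℝ≥0∞)
            + ∫⁻ ω, PLM.nuisanceNorm P (fun w => ghat ω w - g₀ w) ^ 2 ∂μ)
 := by
  have hR : ∀ᵐ z ∂P, ‖z.1‖ ≤ √(d * CX ^ 2) := hX.mono fun z hz => PLM.norm_le_of_sup_norm_le hz
  have hpsd := PLM.secondMoment_sub_posSemidef hH
  rw [PLM.secondMoment_eq_matrixMean] at hpsd
  have horth := PLM.integral_residual_smul_eq_zero hR hε2 hε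
  obtain rfl := PLM.eq_of_isMinOn_risk hR hlam₀ hpsd hε2 hε hθstar
  obtain ⟨C, hC, hbound⟩ := PLM.exists_mse_bound hR hη hlam₀ hpsd
    (fun A hA => by
      rw [← PLM.secondMoment_eq_matrixMean]; exact PLM.step_size_gap hηmax hA)
    θinit θstar hε2 horth
  refine ⟨C, fun n hn Ω m mΩ μ _ Z ghat hs hest => ?_⟩
  -- The auxiliary variable is the identity map into Ω equipped with `m`; the σ-algebra it generates
  -- is `m` itself.
  have hind : @IndepFun Ω Ω (Finset.Icc 1 n → PLM.Obs d 𝒲) mΩ m MeasurableSpace.pi id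
      (fun ω j => Z j ω) μ := by
    refine (IndepFun_iff_Indep (mβ := m) ..).2 ?_
    rw [MeasurableSpace.comap_id]
    refine indep_of_indep_of_le_right hest.indep ?_
    rw [MeasurableSpace.pi, MeasurableSpace.comap_iSup]
    refine iSup_le fun j => ?_
    rw [MeasurableSpace.comap_comp]
    exact le_iSup₂_of_le j.1 j.2 le_rfl
  have key := PLM.condLExp_mse_le (mS := m) hg₀ hs hC
    (fun g hg b hm hb Z hs hZ => hbound g hg b hm hb n hn Ω μ Z hs hZ)
    (measurable_id'' hest.le) hest.measurable hind
  rw [MeasurableSpace.comap_id] at key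
  exact key
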